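/- For an integer $m\ge 0$ let $$V_m(x)=\frac1{m!}\int_0^\infty \frac{u^m e^{-u}}{\sqrt{x^2+u}}\,du ,\qquad x\in\mathbb R,$$ be the Coulomb potential regularized by a Landau state. For $N\in\mathbb N$, nuclear charge $Z\ge 1$, magnetic field strength $B>0$, and locally integrable real potentials $\widetilde V_j$ ($1\le j\le N$) and $\widetilde W_{jk}$ ($1\le j<k\le N$) on $\mathbb R$, consider the one-dimensional $N$-electron Hamiltonian $$h(N,Z,B^{-1/2})=\sum_{j=1}^N\Big[-\sqrt B\,\frac{d^2}{dx_j^2}-Z\,\widetilde V_j(x_j)\Big]+\sum_{j<k}\widetilde W_{jk}(x_j-x_k)$$ with ground state energy $E_0(N)=\inf\langle\Phi,h\,\Phi\rangle$ over $\Phi\in C_c^\infty(\mathbb R^N;\mathbb C)$ with $\|\Phi\|_{L^2}=1$. Let $E_0^{(k)}(N-1)$ be the ground state energy, defined in the same way, of the $(N-1)$-electron Hamiltonian obtained by omitting all terms that involve $x_k$. The Hamiltonian has a bound state if $E_0(N)<E_0^{(k)}(N-1)$ for every $k$ (when the potentials do not depend on $j,k$ this is $E_0(N)<E_0(N-1)$).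 **Theorem.** There are a constant $a_1>0$ and constants $a_2=a_2(\gamma,C)>0$ (both independent of $\alpha$), and for every $\alpha>0$ a constant $A_\alpha>0$, such that the following holds. Let $\mu,\nu$ be integers with $1\le\nu\le 2\mu$, and suppose that for all $x\in\mathbb R$ $$\widetilde V_j(x)\le V_\mu(x)\quad(\text{all } j),\qquad \widetilde W_{jk}(x)\ge \tfrac1{\sqrt2}\,V_{\nu-1}\big(\tfrac{x}{\sqrt2}\big)\quad(\text{all } j<k).$$ Suppose that either $\nu\le C$ and $\gamma>2$ (the case $\nu=O(1)$), or $\nu\le CN$ and $\gamma>3$ (the case $\nu=O(N)$). If $$N>2Z+A_\alpha Z^{1+\alpha}\qquad\text{and}\qquad a_1e^{Z^{\alpha/4}}>B\ge a_2Z^{\gamma},$$ then $h(N,Z,B^{-1/2})$ has no bound state. -/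

import Mathlib

open scoped ContDiff

noncomputable section

namespace StrongField

/-- The regularized Coulomb potential of the Landau state with angular momentum `-m` (field
strength scaled to `1`), `V_m(x) = (1/m!) ∫₀^∞ u^m e^{-u} (x² + u)^{-1/2} du`. -/
def landauPotential (m : ℕ) (x : ℝ) : ℝ :=
  (1 / (m.factorial : ℝ)) *
    ∫ u in Set.Ioi (0 : ℝ), u ^ m * Real.exp (-u) / Real.sqrt (x ^ 2 + u)

/-- The one-dimensional Hamiltonian of particles labelled by `ι`, acting on `Φ(x)`,
`x = (x_j)_{j ∈ ι}`:
`∑_j [-(1/M) d²/dx_j² - Z V_j(x_j)] + ∑_{j<k} W_{jk}(x_j - x_k)`. -/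
def hamiltonian {ι : Type} [Fintype ι] [LinearOrder ι] (Z M : ℝ)
    (V : ι → ℝ → ℝ) (W : ι → ι → ℝ → ℝ) (Φ : (ι → ℝ) → ℂ) (x : ι → ℝ) : ℂ :=
  ∑ j, (-((1 / M : ℝ) : ℂ) * iteratedDeriv 2 (fun t : ℝ => Φ (Function.update x j t)) (x j)
      - ((Z * V j (x j) : ℝ) : ℂ) * Φ x)
    + ∑ j, ∑ k, if j < k then ((W j k (x j - x k) : ℝ) : ℂ) * Φ x else 0

/-- Normalized trial functions: `Φ ∈ C_c^∞(ℝ^ι; ℂ)` with `‖Φ‖_{L²} = 1`. -/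
def IsTrial {ι : Type} [Fintype ι] (Φ : (ι → ℝ) → ℂ) : Prop :=
  ContDiff ℝ ∞ Φ ∧ HasCompactSupport Φ ∧ ∫ x, ‖Φ x‖ ^ 2 = 1

/-- The ground state energy `inf_{‖Φ‖ = 1} ⟨Φ, h Φ⟩`. For locally integrable potentials whose
sum is bounded below, `C_c^∞` is a form core, so this is the bottom of the spectrum of `h`. -/
def groundEnergy {ι : Type} [Fintype ι] [LinearOrder ι] (Z M : ℝ)
    (V : ι → ℝ → ℝ) (W : ι → ι → ℝ → ℝ) : EReal :=
  ⨅ Φ : {Φ : (ι → ℝ) → ℂ // IsTrial Φ},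
    (((∫ x, (starRingEnd ℂ) (Φ.1 x) * hamiltonian Z M V W Φ.1 x).re : ℝ) : EReal)

/-- The ground state energy of the `(N-1)`-particle Hamiltonian obtained from the `N`-particle
one by omitting all terms that involve `x_k`. -/
def groundEnergyOmit {N : ℕ} (Z M : ℝ) (V : Fin N → ℝ → ℝ) (W : Fin N → Fin N → ℝ → ℝ)
    (k : Fin N) : EReal :=
  groundEnergy (ι := {j : Fin N // j ≠ k}) Z M (fun j => V j) (fun i j => W i j)

/-- The `N`-particle Hamiltonian has a bound state, in the sense `E₀(N) < E₀(N - 1)`: its ground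
state energy is below that of each system left after removing one particle. If the potentials do
not depend on the particle labels, the energies `groundEnergyOmit Z M V W k` all agree. -/
def HasBoundState {N : ℕ} (Z M : ℝ) (V : Fin N → ℝ → ℝ) (W : Fin N → Fin N → ℝ → ℝ) : Prop :=
  ∀ k : Fin N, groundEnergy Z M V W < groundEnergyOmit Z M V W k

end StrongField

end

/-! Lieb's localization argument with the weights `χ_k = √(x_k² + R²)`. Put `ρ² = ∑_k χ_k²`. By
the IMS formula, `∑_k ⟨χ_k f/ρ, h χ_k f/ρ⟩` exceeds `⟨f, h f⟩` by at most `N/M · ‖f/ρ‖²`, because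
`|∇χ_k| ≤ 1`. In the `k`-th term the other particles contribute at least `E₀^{(k)}(N - 1)` times
the squared norm, and symmetrizing the repulsion felt by particle `k` over pairs bounds the sum of
these repulsions below by `(N - 1)/2 · ∫ ∑_k χ_k |f/ρ|²`. The attraction by the nucleus is not of
order `1/χ_k`, but part of the kinetic energy of particle `k` makes it so: as
`-(1/M) d²/dx² ≥ (φ' - φ²)/M`, the choice `φ = arsinh (x/s)/√(x² + R²)` turns `Z/√(x² + s²)` into
`Z'/√(x² + R²)` with `Z'/Z = O(1 + log² (R/s))`. For `R = 1/(MZ)` both `Z'` and the localization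
error are then beaten by the repulsion as soon as `N` exceeds a multiple of `Z'`. -/

noncomputable section

namespace StrongField

open MeasureTheory

open scoped RealInnerProductSpace Topology

section LandauPotential

open Set

open scoped Nat

theorem integrableOn_pow_mul_exp_neg (m : ℕ) :
    IntegrableOn (fun u : ℝ => u ^ m * Real.exp (-u)) (Ioi 0) := by
  refine (Real.GammaIntegral_convergent (s := m + 1) (by positivity)).congr_fun ?_
    measurableSet_Ioi
  intro u _
  simp [mul_comm]

theorem integral_pow_mul_exp_neg (m : ℕ) :
    ∫ u in Ioi (0 : ℝ), u ^ m * Real.exp (-u) = m ! := by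
  rw [← Real.Gamma_nat_eq_factorial, Real.Gamma_eq_integral (by positivity)]
  refine setIntegral_congr_fun measurableSet_Ioi ?_
  intro u _
  simp [mul_comm]

theorem integrableOn_pow_mul_exp_neg_div_sqrt (m : ℕ) (x : ℝ) :
    IntegrableOn (fun u : ℝ => u ^ m * Real.exp (-u) / √(x ^ 2 + u)) (Ioi 0) := by
  refine Integrable.mono' (Real.GammaIntegral_convergent (s := m + 1 / 2) (by positivity))
    (Measurable.aestronglyMeasurable (by fun_prop)) ?_
  refine (ae_restrict_iff' measurableSet_Ioi).2 (.of_forall fun u (hu : 0 < u) => ?_)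
  have hpow : u ^ ((m : ℝ) + 1 / 2 - 1) = u ^ m / √u := by
    rw [Real.sqrt_eq_rpow, ← Real.rpow_natCast, ← Real.rpow_sub hu]
    congr 1; ring
  rw [Real.norm_of_nonneg (by positivity), hpow]
  calc u ^ m * Real.exp (-u) / √(x ^ 2 + u)
      ≤ u ^ m * Real.exp (-u) / √u := by gcongr; nlinarith
    _ = _ := by ring

/-- Jensen's inequality for the Gamma distribution with mean `m + 1`, with the supporting line
`c + b (u - (m + 1))` given explicitly. -/
theorem integral_pow_mul_exp_neg_mul_le {m : ℕ} {h : ℝ → ℝ} {b c : ℝ}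
    (hi : IntegrableOn (fun u : ℝ => u ^ m * Real.exp (-u) * h u) (Ioi 0))
    (hle : ∀ u, 0 < u → h u ≤ c + b * (u - (m + 1))) :
    ∫ u in Ioi (0 : ℝ), u ^ m * Real.exp (-u) * h u ≤ m ! * c := by
  have hi₀ := (integrableOn_pow_mul_exp_neg m).const_mul (c - b * (m + 1))
  have hi₁ := (integrableOn_pow_mul_exp_neg (m + 1)).const_mul b
  calc ∫ u in Ioi (0 : ℝ), u ^ m * Real.exp (-u) * h u
      ≤ ∫ u in Ioi (0 : ℝ), ((c - b * (m + 1)) * (u ^ m * Real.exp (-u))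
          + b * (u ^ (m + 1) * Real.exp (-u))) := by
        refine setIntegral_mono_on hi (hi₀.add hi₁) measurableSet_Ioi fun u (hu : 0 < u) => ?_
        calc u ^ m * Real.exp (-u) * h u
            ≤ u ^ m * Real.exp (-u) * (c + b * (u - (m + 1))) := by gcongr; exact hle u hu
          _ = _ := by ring
    _ = m ! * c := by
        rw [integral_add hi₀ hi₁, integral_const_mul, integral_const_mul,
          integral_pow_mul_exp_neg, integral_pow_mul_exp_neg, Nat.factorial_succ]
        push_cast
        ring

theorem one_div_sqrt_tangent_le {a b : ℝ} (ha : 0 < a) (hb : 0 < b) :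
    1 / √a - (b - a) / (2 * √a ^ 3) ≤ 1 / √b := by
  have : 0 < √a := Real.sqrt_pos.2 ha
  have : 0 < √b := Real.sqrt_pos.2 hb
  have h : 1 / √b - (1 / √a - (√b ^ 2 - √a ^ 2) / (2 * √a ^ 3))
      = (√b - √a) ^ 2 * (√b + 2 * √a) / (2 * √a ^ 3 * √b) := by
    field_simp; ring
  rw [Real.sq_sqrt hb.le, Real.sq_sqrt ha.le] at h
  rw [← sub_nonneg, h]
  positivity

theorem div_sqrt_le_tangent {x n u : ℝ} (hn : 0 < n) (hu : 0 < u) :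
    u / √(x ^ 2 + u) ≤ n / √(x ^ 2 + n)
      + (√(x ^ 2 + n) ^ 2 + x ^ 2) / (2 * √(x ^ 2 + n) ^ 3) * (u - n) := by
  have : 0 < √(x ^ 2 + n) := Real.sqrt_pos.2 (by positivity)
  have : 0 < √(x ^ 2 + u) := Real.sqrt_pos.2 (by positivity)
  have hn' : n = √(x ^ 2 + n) ^ 2 - x ^ 2 := by rw [Real.sq_sqrt (by positivity)]; ring
  have hu' : u = √(x ^ 2 + u) ^ 2 - x ^ 2 := by rw [Real.sq_sqrt (by positivity)]; ring
  set l := √(x ^ 2 + n)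
  set t := √(x ^ 2 + u)
  have h : n / l + (l ^ 2 + x ^ 2) / (2 * l ^ 3) * (u - n) - u / t
      = (t - l) ^ 2 / (2 * l) + x ^ 2 * ((t - l) ^ 2 * (t + 2 * l) / (2 * l ^ 3 * t)) := by
    rw [hn', hu']
    field_simp; ring
  rw [← sub_nonneg, h]
  positivity

theorem one_div_sqrt_le_landauPotential (m : ℕ) (x : ℝ) :
    1 / √(x ^ 2 + (m + 1)) ≤ landauPotential m x := by
  have hjensen := integral_pow_mul_exp_neg_mul_le (m := m)
    (h := fun u => -(1 / √(x ^ 2 + u))) (b := 1 / (2 * √(x ^ 2 + (m + 1)) ^ 3))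
    (c := -(1 / √(x ^ 2 + (m + 1))))
    ((integrableOn_pow_mul_exp_neg_div_sqrt m x).neg.congr_fun
      (fun u _ => by simp only [Pi.neg_apply]; ring) measurableSet_Ioi)
    fun u hu => by
      have h := one_div_sqrt_tangent_le (by positivity : 0 < x ^ 2 + ((m : ℝ) + 1))
        (by positivity : 0 < x ^ 2 + u)
      linear_combination h
  simp only [mul_neg, mul_one_div, integral_neg, neg_le_neg_iff] at hjensen
  rwa [landauPotential, one_div_mul_eq_div, le_div_iff₀ (by positivity), one_div_mul_eq_div]

theorem landauPotential_succ_le (n : ℕ) (x : ℝ) :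
    landauPotential (n + 1) x ≤ 1 / √(x ^ 2 + (n + 1)) := by
  have heq : ∀ u : ℝ, u ^ (n + 1) * Real.exp (-u) / √(x ^ 2 + u)
      = u ^ n * Real.exp (-u) * (u / √(x ^ 2 + u)) := fun u => by ring
  have hjensen := integral_pow_mul_exp_neg_mul_le (m := n)
    ((integrableOn_pow_mul_exp_neg_div_sqrt (n + 1) x).congr_fun (fun u _ => heq u)
      measurableSet_Ioi)
    fun u hu => div_sqrt_le_tangent (x := x) (n.cast_add_one_pos (α := ℝ)) hu
  simp only [landauPotential, heq]
  rw [one_div_mul_eq_div, div_le_iff₀ (by positivity)]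
  refine hjensen.trans_eq ?_
  rw [Nat.factorial_succ]
  push_cast
  ring

theorem one_div_sqrt_le_scaled_landauPotential {n : ℕ} (hn : 1 ≤ n) (x : ℝ) :
    1 / √(x ^ 2 + 2 * n) ≤ 1 / √2 * landauPotential (n - 1) (x / √2) := by
  have hV := one_div_sqrt_le_landauPotential (n - 1) (x / √2)
  rw [Nat.cast_pred hn, sub_add_cancel] at hV
  have hx : x ^ 2 + 2 * n = 2 * ((x / √2) ^ 2 + n) := by
    rw [div_pow, Real.sq_sqrt (by norm_num)]; ring
  rw [hx, Real.sqrt_mul (by norm_num), ← one_div_mul_one_div]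
  gcongr

theorem landauPotential_le_one_div_sqrt {m : ℕ} {r : ℝ} (hr : 0 < r) (hrm : r ≤ m) (x : ℝ) :
    landauPotential m x ≤ 1 / √(x ^ 2 + r) := by
  obtain ⟨n, rfl⟩ := Nat.exists_eq_succ_of_ne_zero
    (Nat.cast_pos.1 (hr.trans_le hrm) : 0 < m).ne'
  refine (landauPotential_succ_le n x).trans ?_
  push_cast at hrm
  gcongr

end LandauPotential

section Riccati

theorem hasDerivAt_sqrt_sq_add_sq {R : ℝ} (hR : R ≠ 0) (x : ℝ) :
    HasDerivAt (fun x : ℝ => √(x ^ 2 + R ^ 2)) (x / √(x ^ 2 + R ^ 2)) x := by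
  have h : HasDerivAt (fun x : ℝ => x ^ 2 + R ^ 2) (2 * x) x := by
    simpa using (hasDerivAt_pow 2 x).add_const (R ^ 2)
  refine (h.sqrt (by positivity)).congr_deriv ?_
  field_simp

theorem hasDerivAt_arsinh_div {s : ℝ} (hs : 0 < s) (x : ℝ) :
    HasDerivAt (fun x : ℝ => Real.arsinh (x / s)) (1 / √(x ^ 2 + s ^ 2)) x := by
  have h : 1 + (x / s) ^ 2 = (x ^ 2 + s ^ 2) / s ^ 2 := by field_simp; ring
  refine ((hasDerivAt_id' x).div_const s).arsinh.congr_deriv ?_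
  rw [h, Real.sqrt_div' _ (sq_nonneg s), Real.sqrt_sq hs.le, smul_eq_mul]
  field_simp

theorem abs_arsinh_le (x : ℝ) : |Real.arsinh x| ≤ Real.log (2 * √(1 + x ^ 2)) := by
  have habs : |Real.arsinh x| = Real.arsinh |x| := by
    rcases le_total 0 x with h | h
    · rw [abs_of_nonneg h, abs_of_nonneg (Real.arsinh_nonneg_iff.2 h)]
    · rw [abs_of_nonpos h, abs_of_nonpos (Real.arsinh_nonpos_iff.2 h), Real.arsinh_neg]
  have hx : |x| ≤ √(1 + x ^ 2) := Real.abs_le_sqrt (by linarith)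
  rw [habs, Real.arsinh, sq_abs]
  exact Real.log_le_log (by positivity) (by linarith)

theorem abs_arsinh_div_le {s R : ℝ} (hs : 0 < s) (hsR : s ≤ R) (x : ℝ) :
    |Real.arsinh (x / s)| ≤ Real.log (2 * R / s) + 2 * √(√(x ^ 2 + R ^ 2) / R) := by
  have hR : 0 < R := hs.trans_le hsR
  have hsqrt : √(1 + (x / s) ^ 2) ≤ √(x ^ 2 + R ^ 2) / s := by
    have h : 1 + (x / s) ^ 2 = (x ^ 2 + s ^ 2) / s ^ 2 := by field_simp; ring
    rw [h, Real.sqrt_div' _ (sq_nonneg s), Real.sqrt_sq hs.le]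
    gcongr
  set T := √(x ^ 2 + R ^ 2)
  have hT : 0 < T := Real.sqrt_pos.2 (by positivity)
  have hlog : Real.log (T / R) ≤ 2 * √(T / R) := by
    have h := Real.log_le_sub_one_of_pos (Real.sqrt_pos.2 (by positivity : 0 < T / R))
    rw [Real.log_sqrt (by positivity)] at h
    linarith
  calc |Real.arsinh (x / s)| ≤ Real.log (2 * √(1 + (x / s) ^ 2)) := abs_arsinh_le _
    _ ≤ Real.log (2 * R / s * (T / R)) := by
        refine Real.log_le_log (by positivity)
          ((mul_le_mul_of_nonneg_left hsqrt two_pos.le).trans_eq ?_)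
        field_simp
    _ = Real.log (2 * R / s) + Real.log (T / R) := Real.log_mul (by positivity) (by positivity)
    _ ≤ _ := by linarith

theorem arsinh_div_sq_le {s R : ℝ} (hs : 0 < s) (hsR : s ≤ R) (x : ℝ) :
    Real.arsinh (x / s) ^ 2 ≤ 2 * Real.log (2 * R / s) ^ 2 + 8 * (√(x ^ 2 + R ^ 2) / R) := by
  have hR : 0 < R := hs.trans_le hsR
  set q := √(√(x ^ 2 + R ^ 2) / R)
  have hq : q ^ 2 = √(x ^ 2 + R ^ 2) / R := Real.sq_sqrt (by positivity)
  have habs : |Real.arsinh (x / s)| ^ 2 ≤ (Real.log (2 * R / s) + 2 * q) ^ 2 := by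
    gcongr; exact abs_arsinh_div_le hs hsR x
  rw [sq_abs] at habs
  nlinarith [sq_nonneg (Real.log (2 * R / s) - 2 * q)]

/-- The Riccati subsolution `arsinh (x / s) / √(x² + R²)`: the logarithmic derivative of a positive
function on which `-R d²/dx² - (x² + s²)^{-1/2} + K (x² + R²)^{-1/2}` is nonnegative, for
`K = O(1 + log² (R / s))`. -/
def riccati (s R x : ℝ) : ℝ :=
  Real.arsinh (x / s) / √(x ^ 2 + R ^ 2)

/-- The derivative of `riccati s R`. -/
def riccatiDeriv (s R x : ℝ) : ℝ :=
  1 / (√(x ^ 2 + s ^ 2) * √(x ^ 2 + R ^ 2))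
    - x * Real.arsinh (x / s) / √(x ^ 2 + R ^ 2) ^ 3

theorem hasDerivAt_riccati {s R : ℝ} (hs : 0 < s) (hR : R ≠ 0) (x : ℝ) :
    HasDerivAt (riccati s R) (riccatiDeriv s R x) x := by
  have hT : √(x ^ 2 + R ^ 2) ≠ 0 := (Real.sqrt_pos.2 (by positivity)).ne'
  have hS : √(x ^ 2 + s ^ 2) ≠ 0 := (Real.sqrt_pos.2 (by positivity)).ne'
  refine ((hasDerivAt_arsinh_div hs x).div (hasDerivAt_sqrt_sq_add_sq hR x) hT).congr_deriv ?_
  rw [riccatiDeriv]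
  field_simp

theorem continuous_riccatiDeriv {s R : ℝ} (hs : s ≠ 0) (hR : R ≠ 0) :
    Continuous (riccatiDeriv s R) := by
  have hT : ∀ x : ℝ, √(x ^ 2 + R ^ 2) ≠ 0 := fun x => (Real.sqrt_pos.2 (by positivity)).ne'
  have hS : ∀ x : ℝ, √(x ^ 2 + s ^ 2) ≠ 0 := fun x => (Real.sqrt_pos.2 (by positivity)).ne'
  have ha : Continuous fun x => Real.arsinh (x / s) :=
    Real.continuous_arsinh.comp (continuous_id.div_const s)
  exact (continuous_const.div (by fun_prop) fun x => mul_ne_zero (hS x) (hT x)).sub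
    ((continuous_id.mul ha).div (by fun_prop) fun x => pow_ne_zero 3 (hT x))

theorem le_mul_riccatiDeriv {s R : ℝ} (hs : 0 < s) (hR : 0 < R) (x : ℝ) :
    1 / √(x ^ 2 + s ^ 2) - 1 / √(x ^ 2 + R ^ 2)
        - R * (1 + Real.arsinh (x / s) ^ 2) / (2 * √(x ^ 2 + R ^ 2) ^ 2)
      ≤ R * riccatiDeriv s R x := by
  have hT2 : √(x ^ 2 + R ^ 2) ^ 2 = x ^ 2 + R ^ 2 := Real.sq_sqrt (by positivity)
  have hS2 : √(x ^ 2 + s ^ 2) ^ 2 = x ^ 2 + s ^ 2 := Real.sq_sqrt (by positivity)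
  have hT : 0 < √(x ^ 2 + R ^ 2) := Real.sqrt_pos.2 (by positivity)
  have hS : 0 < √(x ^ 2 + s ^ 2) := Real.sqrt_pos.2 (by positivity)
  rw [riccatiDeriv]
  set a := Real.arsinh (x / s)
  set T := √(x ^ 2 + R ^ 2)
  set S := √(x ^ 2 + s ^ 2)
  have hfirst : 1 / S - 1 / T ≤ R * (1 / (S * T)) := by
    have hTS : T - R ≤ S := by nlinarith
    rw [div_sub_div _ _ hS.ne' hT.ne', mul_one_div]
    gcongr
    linarith
  have hsecond : R * (x * a / T ^ 3) ≤ R * (1 + a ^ 2) / (2 * T ^ 2) := by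
    have hxa : x * a ≤ T * ((1 + a ^ 2) / 2) := by
      have hxT : |x| ≤ T := Real.abs_le_sqrt (by nlinarith)
      calc x * a ≤ |x| * |a| := by rw [← abs_mul]; exact le_abs_self _
        _ ≤ T * ((1 + a ^ 2) / 2) := by
          gcongr
          nlinarith [sq_nonneg (|a| - 1), sq_abs a]
    calc R * (x * a / T ^ 3) ≤ R * (T * ((1 + a ^ 2) / 2) / T ^ 3) := by gcongr
      _ = _ := by field_simp
  linarith

theorem riccati_inequality {s R : ℝ} (hs : 0 < s) (hsR : s ≤ R) (x : ℝ) :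
    1 / √(x ^ 2 + s ^ 2) - (14 + 3 * Real.log (2 * R / s) ^ 2) / √(x ^ 2 + R ^ 2)
      ≤ R * (riccatiDeriv s R x - riccati s R x ^ 2) := by
  have hR : 0 < R := hs.trans_le hsR
  have hderiv := le_mul_riccatiDeriv hs hR x
  have ha2 := arsinh_div_sq_le hs hsR x
  have hRT : R ≤ √(x ^ 2 + R ^ 2) := Real.le_sqrt_of_sq_le (by nlinarith)
  rw [riccati]
  set L := Real.log (2 * R / s)
  set a := Real.arsinh (x / s)
  set T := √(x ^ 2 + R ^ 2)
  have hT : 0 < T := hR.trans_le hRT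
  have herror : R * (1 + a ^ 2) / (2 * T ^ 2) + R * (a / T) ^ 2 ≤ (13 + 3 * L ^ 2) / T := by
    have hfactor : R * (1 + a ^ 2) / (2 * T ^ 2) + R * (a / T) ^ 2
        = R / T * (1 / 2 + 3 / 2 * a ^ 2) / T := by field_simp; ring
    have hRT1 : R / T ≤ 1 := (div_le_one hT).2 hRT
    rw [hfactor]
    gcongr
    calc R / T * (1 / 2 + 3 / 2 * a ^ 2)
        ≤ R / T * (1 / 2 + 3 / 2 * (2 * L ^ 2 + 8 * (T / R))) := by gcongr
      _ = R / T * (1 / 2 + 3 * L ^ 2) + 12 := by field_simp; ring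
      _ ≤ 1 * (1 / 2 + 3 * L ^ 2) + 12 := by gcongr
      _ ≤ 13 + 3 * L ^ 2 := by linarith
  have hsplit : (14 + 3 * L ^ 2) / T = 1 / T + (13 + 3 * L ^ 2) / T := by ring
  linarith

end Riccati

section LocalIntegrability

open Set Filter

variable {ι : Type*} [Fintype ι]

theorem locallyIntegrable_comp_eval {X : ι → Type*} [∀ i, TopologicalSpace (X i)]
    [∀ i, MeasurableSpace (X i)] {μ : ∀ i, Measure (X i)} [∀ i, SigmaFinite (μ i)]
    [∀ i, IsLocallyFiniteMeasure (μ i)] {E : Type*} [NormedAddCommGroup E] {j : ι} {v : X j → E}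
    (hv : LocallyIntegrable v (μ j)) :
    LocallyIntegrable (fun x : ∀ i, X i => v (x j)) (Measure.pi μ) := by
  intro x
  obtain ⟨t, ht, hvt⟩ := hv (x j)
  have hnhds : ∀ i, ∃ s ∈ 𝓝 (x i), μ i s < ⊤ ∧ ∀ h : i = j, s ⊆ h ▸ t := by
    intro i
    obtain ⟨s, hs, hfin⟩ := (μ i).finiteAt_nhds (x i)
    by_cases h : i = j
    · subst h
      exact ⟨s ∩ t, inter_mem hs ht, (measure_mono inter_subset_left).trans_lt hfin,
        fun _ => inter_subset_right⟩
    · exact ⟨s, hs, hfin, fun h' => (h h').elim⟩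
  choose s hs hfin hst using hnhds
  have : ∀ i, IsFiniteMeasure ((μ i).restrict (s i)) := fun i =>
    isFiniteMeasure_restrict.2 (hfin i).ne
  refine ⟨univ.pi s, set_pi_mem_nhds finite_univ fun i _ => hs i, ?_⟩
  rw [IntegrableOn, Measure.restrict_pi_pi]
  exact integrable_comp_eval (hvt.mono_set (hst j rfl))

theorem locallyIntegrable_comp_sub {v : ℝ → ℝ} (hv : LocallyIntegrable v) {j k : ι}
    (h : j ≠ k) : LocallyIntegrable fun x : ι → ℝ => v (x j - x k) := by
  classical
  let shear : (ι → ℝ) ≃ₜ (ι → ℝ) :=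
    { toFun := fun x => Function.update x j (x j - x k)
      invFun := fun x => Function.update x j (x j + x k)
      left_inv := fun x => by simp [h.symm]
      right_inv := fun x => by simp [h.symm]
      continuous_toFun := by fun_prop
      continuous_invFun := by fun_prop }
  have hshear : MeasurePreserving shear := by
    convert Real.volume_preserving_transvectionStruct
      (⟨j, k, h, -1⟩ : Matrix.TransvectionStruct ι ℝ) using 1
    funext x i
    rcases eq_or_ne i j with rfl | hij
    · simp [shear, Matrix.transvection, Matrix.single_mulVec, sub_eq_add_neg]
    · simp [shear, Matrix.transvection, Matrix.single_mulVec, hij]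
  have hcomp : LocallyIntegrable (fun x : ι → ℝ => v (x j)) :=
    locallyIntegrable_comp_eval (μ := fun _ => volume) hv
  rw [← hshear.map_eq, locallyIntegrable_map_homeomorph] at hcomp
  simpa [shear, Function.comp_def] using hcomp

end LocalIntegrability

section NormSq

variable {X F : Type*} [TopologicalSpace X] [NormedAddCommGroup F] {f : X → F}

theorem hasCompactSupport_norm_sq (hc : HasCompactSupport f) :
    HasCompactSupport fun x => ‖f x‖ ^ 2 :=
  hc.comp_left (g := fun y : F => ‖y‖ ^ 2) (by simp)

variable [MeasurableSpace X] [OpensMeasurableSpace X] {μ : Measure X}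

theorem integrable_norm_sq [IsFiniteMeasureOnCompacts μ] (hf : Continuous f)
    (hc : HasCompactSupport f) : Integrable (fun x => ‖f x‖ ^ 2) μ :=
  (hf.norm.pow 2).integrable_of_hasCompactSupport (hasCompactSupport_norm_sq hc)

theorem integrable_mul_norm_sq [T2Space X] {v : X → ℝ} (hv : LocallyIntegrable v μ)
    (hf : Continuous f) (hc : HasCompactSupport f) : Integrable (fun x => v x * ‖f x‖ ^ 2) μ :=
  hv.integrable_smul_right_of_hasCompactSupport (hf.norm.pow 2) (hasCompactSupport_norm_sq hc)

end NormSq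

section Calculus

variable {E F : Type*} [NormedAddCommGroup E] [NormedSpace ℝ E] [NormedAddCommGroup F]

theorem continuous_fderiv_apply [NormedSpace ℝ F] {f : E → F} {n : WithTop ℕ∞}
    (hf : ContDiff ℝ n f) (hn : n ≠ 0) (v : E) : Continuous fun x => fderiv ℝ f x v :=
  (hf.continuous_fderiv hn).clm_apply continuous_const

theorem integrable_norm_fderiv_apply_sq [NormedSpace ℝ F] [MeasurableSpace E]
    [OpensMeasurableSpace E] {μ : Measure E} [IsFiniteMeasureOnCompacts μ] {f : E → F}
    {n : WithTop ℕ∞} (hf : ContDiff ℝ n f) (hn : n ≠ 0) (hc : HasCompactSupport f) (v : E) :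
    Integrable (fun x => ‖fderiv ℝ f x v‖ ^ 2) μ :=
  integrable_norm_sq (continuous_fderiv_apply hf hn v) (hc.fderiv_apply (𝕜 := ℝ) v)

variable [InnerProductSpace ℝ F] {f : E → F}

theorem hasLineDerivAt_norm_sq (hf : Differentiable ℝ f) (x v : E) :
    HasLineDerivAt ℝ (fun x => ‖f x‖ ^ 2) (2 * ⟪f x, fderiv ℝ f x v⟫) x v := by
  have h := ((hf x).hasFDerivAt.hasLineDerivAt v).norm_sq
  rwa [zero_smul, add_zero] at h

/-- The IMS localization formula for weights `χ i` that are not normalized. -/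
theorem sum_norm_fderiv_smul_sq_le {κ : Type*} [Fintype κ] {χ : κ → E → ℝ} {ρ : E → ℝ} {x : E}
    (hχ : ∀ i, DifferentiableAt ℝ (χ i) x) (hρ : DifferentiableAt ℝ ρ x)
    (hf : DifferentiableAt ℝ f x) (hsum : ∀ y, ∑ i, χ i y ^ 2 = ρ y ^ 2) (v : E) :
    ∑ i, ‖fderiv ℝ (fun y => χ i y • f y) x v‖ ^ 2
      ≤ ‖fderiv ℝ (fun y => ρ y • f y) x v‖ ^ 2 + (∑ i, fderiv ℝ (χ i) x v ^ 2) * ‖f x‖ ^ 2 := by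
  have hexpand : ∀ ψ : E → ℝ, DifferentiableAt ℝ ψ x →
      ‖fderiv ℝ (fun y => ψ y • f y) x v‖ ^ 2 = ψ x ^ 2 * ‖fderiv ℝ f x v‖ ^ 2
        + ψ x * fderiv ℝ ψ x v * (2 * ⟪fderiv ℝ f x v, f x⟫)
        + fderiv ℝ ψ x v ^ 2 * ‖f x‖ ^ 2 := by
    intro ψ hψ
    rw [fderiv_fun_smul hψ hf]
    simp only [add_apply, smul_apply, ContinuousLinearMap.smulRight_apply]
    rw [norm_add_sq_real, inner_smul_left, inner_smul_right, norm_smul, norm_smul, mul_pow,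
      mul_pow, Real.norm_eq_abs, Real.norm_eq_abs, sq_abs, sq_abs, RCLike.conj_to_real]
    ring
  have hcross : ∑ i, χ i x * fderiv ℝ (χ i) x v = ρ x * fderiv ℝ ρ x v := by
    have h := congrArg (fun g : E → ℝ => fderiv ℝ g x v) (funext hsum)
    rw [fderiv_fun_sum (A := fun i y => χ i y ^ 2) fun i _ => (hχ i).pow 2] at h
    simp only [fderiv_fun_pow _ (hχ _), fderiv_fun_pow _ hρ] at h
    simpa [mul_assoc, ← Finset.mul_sum] using h
  simp_rw [hexpand _ hρ, fun i => hexpand _ (hχ i), Finset.sum_add_distrib, ← Finset.sum_mul]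
  rw [hsum, hcross]
  nlinarith [mul_nonneg (sq_nonneg (fderiv ℝ ρ x v)) (sq_nonneg ‖f x‖)]

variable [MeasurableSpace E] [BorelSpace E] {μ : Measure E} [FiniteDimensional ℝ E]
  [μ.IsAddHaarMeasure]

theorem integral_inner_fderiv_fderiv_eq_neg (hf : ContDiff ℝ 2 f)
    (hc : HasCompactSupport f) (v : E) :
    ∫ x, ⟪f x, fderiv ℝ (fun y => fderiv ℝ f y v) x v⟫ ∂μ = -∫ x, ‖fderiv ℝ f x v‖ ^ 2 ∂μ := by
  have hf' : ContDiff ℝ 1 fun y => fderiv ℝ f y v :=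
    (hf.fderiv_right (m := 1) (by norm_num)).clm_apply contDiff_const
  have hcont := hf.continuous
  have hcont' := continuous_fderiv_apply hf two_ne_zero v
  have hcont'' := continuous_fderiv_apply hf' one_ne_zero v
  have hc' := hc.fderiv_apply (𝕜 := ℝ) v
  simp_rw [← real_inner_self_eq_norm_sq]
  refine integral_bilinear_fderiv_right_eq_neg_left_of_integrable (B := innerSL ℝ) ?_ ?_ ?_
    (fun x _ => hf.differentiable two_ne_zero x) (fun x _ => hf'.differentiable one_ne_zero x)
  · exact (hcont'.inner hcont').integrable_of_hasCompactSupport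
      (hc'.mono fun x hx h => hx (by simp [h]))
  · exact (hcont.inner hcont'').integrable_of_hasCompactSupport
      (hc.mono fun x hx h => hx (by simp [h]))
  · exact (hcont.inner hcont').integrable_of_hasCompactSupport
      (hc.mono fun x hx h => hx (by simp [h]))

theorem integral_riccati_mul_norm_sq_le {φ φ' : E → ℝ} {v : E} (hφ : Continuous φ)
    (hφ' : Continuous φ') (hderiv : ∀ x, HasLineDerivAt ℝ φ (φ' x) x v) (hf : ContDiff ℝ 1 f)
    (hc : HasCompactSupport f) :
    ∫ x, (φ' x - φ x ^ 2) * ‖f x‖ ^ 2 ∂μ ≤ ∫ x, ‖fderiv ℝ f x v‖ ^ 2 ∂μ := by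
  have hcont := hf.continuous
  have hcont' := continuous_fderiv_apply hf one_ne_zero v
  have hi₀ : Integrable (fun x => φ x * ‖f x‖ ^ 2) μ :=
    integrable_mul_norm_sq hφ.locallyIntegrable hcont hc
  have hi₁ : Integrable (fun x => φ' x * ‖f x‖ ^ 2) μ :=
    integrable_mul_norm_sq hφ'.locallyIntegrable hcont hc
  have hi₂ : Integrable (fun x => φ x ^ 2 * ‖f x‖ ^ 2) μ :=
    integrable_mul_norm_sq (hφ.pow 2).locallyIntegrable hcont hc
  have hi₃ : Integrable (fun x => φ x * (2 * ⟪f x, fderiv ℝ f x v⟫)) μ :=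
    (hφ.mul (continuous_const.mul (hcont.inner hcont'))).integrable_of_hasCompactSupport
      (hc.mono fun x hx h => hx (by simp [h]))
  have hparts : ∫ x, φ x * (2 * ⟪f x, fderiv ℝ f x v⟫) ∂μ = -∫ x, φ' x * ‖f x‖ ^ 2 ∂μ :=
    integral_bilinear_hasLineDerivAt_right_eq_neg_left_of_integrable
      (B := ContinuousLinearMap.mul ℝ ℝ) hi₁ hi₃ hi₀ (fun x _ => hderiv x)
      (fun x _ => hasLineDerivAt_norm_sq (hf.differentiable one_ne_zero) x v)
  calc ∫ x, (φ' x - φ x ^ 2) * ‖f x‖ ^ 2 ∂μ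
      = ∫ x, (-(φ x * (2 * ⟪f x, fderiv ℝ f x v⟫)) - φ x ^ 2 * ‖f x‖ ^ 2) ∂μ := by
        have hneg := integral_sub hi₃.neg hi₂
        simp only [Pi.neg_apply, integral_neg, hparts, neg_neg] at hneg
        simp_rw [sub_mul]
        rw [integral_sub hi₁ hi₂, hneg]
    _ ≤ ∫ x, ‖fderiv ℝ f x v‖ ^ 2 ∂μ := by
        refine integral_mono (hi₃.neg.sub hi₂) (integrable_norm_fderiv_apply_sq hf one_ne_zero hc v)
          fun x => ?_
        have hsq : 0 ≤ ‖fderiv ℝ f x v + φ x • f x‖ ^ 2 := by positivity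
        rw [norm_add_sq_real, inner_smul_right, real_inner_comm, norm_smul, mul_pow,
          Real.norm_eq_abs, sq_abs] at hsq
        simp only
        linarith

end Calculus

section PartialDeriv

variable {ι : Type*} [DecidableEq ι] {F : Type*} [NormedAddCommGroup F] [NormedSpace ℝ F]

/-- The partial derivative `∂f/∂x_j`. -/
def partialDeriv (j : ι) (f : (ι → ℝ) → F) (x : ι → ℝ) : F :=
  fderiv ℝ f x (Pi.single j 1)

theorem hasDerivAt_comp_update [Finite ι] {f : (ι → ℝ) → F} (hf : Differentiable ℝ f) (x : ι → ℝ)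
    (j : ι) (t : ℝ) : HasDerivAt (fun t : ℝ => f (Function.update x j t))
      (partialDeriv j f (Function.update x j t)) t := by
  cases nonempty_fintype ι
  exact (hf _).hasFDerivAt.comp_hasDerivAt t (hasDerivAt_update x j t)

variable [Fintype ι]

theorem contDiff_partialDeriv {f : (ι → ℝ) → F} {m n : WithTop ℕ∞} (hf : ContDiff ℝ n f)
    (hmn : m + 1 ≤ n) (j : ι) : ContDiff ℝ m (partialDeriv j f) :=
  (hf.fderiv_right hmn).clm_apply contDiff_const

theorem integrable_norm_partialDeriv_sq {f : (ι → ℝ) → F} (hf : ContDiff ℝ 1 f)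
    (hc : HasCompactSupport f) (j : ι) : Integrable fun x => ‖partialDeriv j f x‖ ^ 2 :=
  integrable_norm_fderiv_apply_sq hf one_ne_zero hc (Pi.single j 1)

theorem iteratedDeriv_two_comp_update {f : (ι → ℝ) → F} (hf : ContDiff ℝ 2 f) (x : ι → ℝ) (j : ι)
    (t : ℝ) : iteratedDeriv 2 (fun t : ℝ => f (Function.update x j t)) t
      = partialDeriv j (partialDeriv j f) (Function.update x j t) := by
  have hderiv : deriv (fun t : ℝ => f (Function.update x j t))
      = fun t => partialDeriv j f (Function.update x j t) :=
    funext fun t => (hasDerivAt_comp_update (hf.differentiable two_ne_zero) x j t).deriv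
  have hf' : ContDiff ℝ 1 (partialDeriv j f) := contDiff_partialDeriv hf (by norm_num) j
  rw [iteratedDeriv_succ, iteratedDeriv_one, hderiv]
  exact (hasDerivAt_comp_update (hf'.differentiable one_ne_zero) x j t).deriv

end PartialDeriv

section EnergyDensity

variable {ι : Type*} [Fintype ι] [DecidableEq ι] {F : Type*} [NormedAddCommGroup F]
  [InnerProductSpace ℝ F]

/-- The density of the quadratic form of `-(1/M) Δ + U`, written with first derivatives only. -/
def energyDensity (M : ℝ) (U : (ι → ℝ) → ℝ) (f : (ι → ℝ) → F) (x : ι → ℝ) : ℝ :=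
  1 / M * ∑ j, ‖partialDeriv j f x‖ ^ 2 + U x * ‖f x‖ ^ 2

variable {M : ℝ} {U : (ι → ℝ) → ℝ} {f : (ι → ℝ) → F}

theorem integrable_energyDensity (hU : LocallyIntegrable U) (hf : ContDiff ℝ 1 f)
    (hc : HasCompactSupport f) : Integrable (energyDensity M U f) :=
  ((integrable_finsetSum _ fun j _ => integrable_norm_partialDeriv_sq hf hc j).const_mul _).add
    (integrable_mul_norm_sq hU hf.continuous hc)

theorem energyDensity_const_smul (c : ℝ) (x : ι → ℝ) :
    energyDensity M U (c • f) x = c ^ 2 * energyDensity M U f x := by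
  simp only [energyDensity, partialDeriv, fderiv_const_smul_field, smul_apply, Pi.smul_apply,
    norm_smul, mul_pow, Real.norm_eq_abs, sq_abs, ← Finset.mul_sum]
  ring

end EnergyDensity

section Hamiltonian

variable {ι : Type} [Fintype ι] [LinearOrder ι] {Z M : ℝ} {V : ι → ℝ → ℝ} {W : ι → ι → ℝ → ℝ}
  {f : (ι → ℝ) → ℂ}

/-- The potential energy `-Z ∑_j V_j(x_j) + ∑_{j<k} W_{jk}(x_j - x_k)` of `hamiltonian`. -/
def potential (Z : ℝ) (V : ι → ℝ → ℝ) (W : ι → ι → ℝ → ℝ) (x : ι → ℝ) : ℝ :=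
  -Z * ∑ j, V j (x j) + ∑ j, ∑ k, if j < k then W j k (x j - x k) else 0

theorem locallyIntegrable_potential (hV : ∀ j, LocallyIntegrable (V j))
    (hW : ∀ j k, j < k → LocallyIntegrable (W j k)) : LocallyIntegrable (potential Z V W) := by
  refine LocallyIntegrable.add ?_ ?_
  · exact (locallyIntegrable_finsetSum _ fun j _ => locallyIntegrable_comp_eval (hV j)).smul (-Z)
  · refine locallyIntegrable_finsetSum _ fun j _ => locallyIntegrable_finsetSum _ fun k _ => ?_
    by_cases h : j < k
    · simpa only [h, if_true] using locallyIntegrable_comp_sub (hW j k h) h.ne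
    · simp only [h, if_false, locallyIntegrable_const]

theorem hamiltonian_eq (hf : ContDiff ℝ 2 f) (x : ι → ℝ) :
    hamiltonian Z M V W f x
      = -(1 / M) • ∑ j, partialDeriv j (partialDeriv j f) x + potential Z V W x • f x := by
  have hW : ∀ j k : ι, (if j < k then ((W j k (x j - x k) : ℝ) : ℂ) * f x else 0)
      = ((if j < k then W j k (x j - x k) else 0 : ℝ) : ℂ) * f x := by
    intro j k; split_ifs <;> simp
  simp only [hamiltonian, potential, iteratedDeriv_two_comp_update hf, Function.update_eq_self, hW,
    Finset.sum_sub_distrib, ← Finset.sum_mul, ← Finset.mul_sum, Complex.real_smul]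
  push_cast
  rw [← Finset.mul_sum]
  ring

theorem integrable_conj_mul_hamiltonian (hV : ∀ j, LocallyIntegrable (V j))
    (hW : ∀ j k, j < k → LocallyIntegrable (W j k)) (hf : ContDiff ℝ 2 f)
    (hc : HasCompactSupport f) :
    Integrable fun x => (starRingEnd ℂ) (f x) * hamiltonian Z M V W f x := by
  have hconj : Continuous fun x => (starRingEnd ℂ) (f x) :=
    Complex.continuous_conj.comp hf.continuous
  have hc' : HasCompactSupport fun x => (starRingEnd ℂ) (f x) := hc.comp_left (map_zero _)
  have hkin : Continuous fun x => -(1 / M) • ∑ j, partialDeriv j (partialDeriv j f) x :=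
    continuous_const.fun_smul (continuous_finsetSum _ fun j _ => (contDiff_partialDeriv (m := 0)
      (contDiff_partialDeriv hf (m := 1) (by norm_num) j) (by simp) j).continuous)
  have hsplit : ∀ x, (starRingEnd ℂ) (f x) * hamiltonian Z M V W f x
      = (starRingEnd ℂ) (f x) * (-(1 / M) • ∑ j, partialDeriv j (partialDeriv j f) x)
        + potential Z V W x • ((starRingEnd ℂ) (f x) * f x) := fun x => by
    rw [hamiltonian_eq hf, mul_add, mul_smul_comm (potential Z V W x)]
  simp_rw [hsplit]
  exact ((hconj.mul hkin).integrable_of_hasCompactSupport hc'.mul_right).add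
    ((locallyIntegrable_potential hV hW).integrable_smul_right_of_hasCompactSupport
      (hconj.mul hf.continuous) hc'.mul_right)

theorem re_integral_conj_mul_hamiltonian (hV : ∀ j, LocallyIntegrable (V j))
    (hW : ∀ j k, j < k → LocallyIntegrable (W j k)) (hf : ContDiff ℝ 2 f)
    (hc : HasCompactSupport f) :
    (∫ x, (starRingEnd ℂ) (f x) * hamiltonian Z M V W f x).re
      = ∫ x, energyDensity M (potential Z V W) f x := by
  have hkin : ∀ j, Integrable fun x => ⟪f x, partialDeriv j (partialDeriv j f) x⟫ := fun j =>
    (hf.continuous.inner (contDiff_partialDeriv (m := 0) (contDiff_partialDeriv hf (m := 1)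
      (by norm_num) j) (by simp) j).continuous).integrable_of_hasCompactSupport
      (hc.mono fun x hx h => hx (by simp [h]))
  have hgrad := integrable_norm_partialDeriv_sq (hf.of_le one_le_two) hc
  have hparts : ∀ j, ∫ x, ⟪f x, partialDeriv j (partialDeriv j f) x⟫
      = -∫ x, ‖partialDeriv j f x‖ ^ 2 := fun j =>
    integral_inner_fderiv_fderiv_eq_neg hf hc (Pi.single j 1)
  have hpot := integrable_mul_norm_sq (locallyIntegrable_potential (Z := Z) hV hW) hf.continuous hc
  have hre : ∀ x, ((starRingEnd ℂ) (f x) * hamiltonian Z M V W f x).re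
      = -(1 / M) * ∑ j, ⟪f x, partialDeriv j (partialDeriv j f) x⟫
        + potential Z V W x * ‖f x‖ ^ 2 := fun x => by
    rw [hamiltonian_eq hf, mul_comm, ← Complex.inner, inner_add_right, inner_smul_right,
      inner_smul_right, inner_sum, real_inner_self_eq_norm_sq]
  have hswap := integral_re (integrable_conj_mul_hamiltonian (Z := Z) (M := M) hV hW hf hc)
  simp only [RCLike.re_to_complex, hre] at hswap
  simp only [energyDensity]
  rw [← hswap, integral_add ((integrable_finsetSum _ fun j _ => hkin j).const_mul _) hpot,
    integral_add ((integrable_finsetSum _ fun j _ => hgrad j).const_mul _) hpot,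
    integral_const_mul, integral_const_mul, integral_finsetSum _ fun j _ => hkin j,
    integral_finsetSum _ fun j _ => hgrad j]
  simp only [hparts, Finset.sum_neg_distrib, neg_mul_neg]

theorem eq_zero_of_integral_norm_sq_eq_zero {X F : Type*} [TopologicalSpace X]
    [MeasurableSpace X] [OpensMeasurableSpace X] {μ : Measure X} [μ.IsOpenPosMeasure]
    [IsFiniteMeasureOnCompacts μ] [NormedAddCommGroup F] {f : X → F} (hf : Continuous f)
    (hc : HasCompactSupport f) (h : ∫ x, ‖f x‖ ^ 2 ∂μ = 0) : f = 0 := by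
  have hae := (integral_eq_zero_iff_of_nonneg (fun x => by positivity)
    (integrable_norm_sq hf hc)).1 h
  have hzero := (hf.norm.pow 2).ae_eq_iff_eq μ continuous_const |>.1 hae
  funext x
  have hsq : ‖f x‖ ^ 2 = 0 := congrFun hzero x
  simpa using hsq

/-- The variational principle for functions that need not be normalized. -/
theorem mul_integral_norm_sq_le_of_le_groundEnergy {e : ℝ} (hV : ∀ j, LocallyIntegrable (V j))
    (hW : ∀ j k, j < k → LocallyIntegrable (W j k)) (he : (e : EReal) ≤ groundEnergy Z M V W)
    (hf : ContDiff ℝ ∞ f) (hc : HasCompactSupport f) :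
    e * ∫ x, ‖f x‖ ^ 2 ≤ ∫ x, energyDensity M (potential Z V W) f x := by
  rcases (integral_nonneg fun x => sq_nonneg ‖f x‖ : 0 ≤ ∫ x, ‖f x‖ ^ 2).eq_or_lt with h0 | hpos
  · have hzero := eq_zero_of_integral_norm_sq_eq_zero hf.continuous hc h0.symm
    simp [hzero, energyDensity, partialDeriv]
  set n := ∫ x, ‖f x‖ ^ 2
  have hn : (√n)⁻¹ ^ 2 = n⁻¹ := by rw [inv_pow, Real.sq_sqrt hpos.le]
  have hsmooth : ContDiff ℝ ∞ ((√n)⁻¹ • f) := contDiff_const.smul hf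
  have hcompact : HasCompactSupport ((√n)⁻¹ • f) := hc.smul_left (f := fun _ => (√n)⁻¹)
  have htrial : IsTrial ((√n)⁻¹ • f) := by
    refine ⟨hsmooth, hcompact, ?_⟩
    simp only [Pi.smul_apply, norm_smul, mul_pow, Real.norm_eq_abs, sq_abs, hn]
    rw [integral_const_mul, inv_mul_cancel₀ hpos.ne']
  have hle := he.trans (iInf_le _ (⟨_, htrial⟩ : {Φ : (ι → ℝ) → ℂ // IsTrial Φ}))
  rw [EReal.coe_le_coe_iff, re_integral_conj_mul_hamiltonian hV hW (contDiff_infty.1 hsmooth 2)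
    hcompact] at hle
  simp only [energyDensity_const_smul, hn] at hle
  rwa [integral_const_mul, ← div_eq_inv_mul, le_div_iff₀ hpos] at hle

end Hamiltonian

section Merge

variable {ι : Type*} {p : ι → Prop} [DecidablePred p]

/-- The configuration whose coordinates in `p` are those of `y` and whose other coordinates are
those of `z`. -/
def merge (y : {j // p j} → ℝ) (z : {j // ¬ p j} → ℝ) : ι → ℝ :=
  (MeasurableEquiv.piEquivPiSubtypeProd (fun _ : ι => ℝ) p).symm (y, z)

theorem merge_apply (y : {j // p j} → ℝ) (z : {j // ¬ p j} → ℝ) (i : ι) :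
    merge y z i = if h : p i then y ⟨i, h⟩ else z ⟨i, h⟩ := rfl

theorem restrict_merge (y : {j // p j} → ℝ) (z : {j // ¬ p j} → ℝ) :
    (fun i : {j // p j} => merge y z i) = y := by
  funext i
  rw [merge_apply, dif_pos i.2]

theorem merge_add_smul_single [DecidableEq ι] (y : {j // p j} → ℝ) (z : {j // ¬ p j} → ℝ)
    (i : {j // p j}) (t : ℝ) :
    merge (y + t • Pi.single i 1) z = merge y z + t • Pi.single (i : ι) 1 := by
  funext l
  by_cases hl : p l
  · simp [merge_apply, hl, Pi.single_apply, Subtype.ext_iff]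
  · simp [merge_apply, hl, show l ≠ i from fun h => hl (h ▸ i.2)]

theorem contDiff_merge [Fintype ι] (z : {j // ¬ p j} → ℝ) :
    ContDiff ℝ ∞ fun y : {j // p j} → ℝ => merge y z := by
  refine contDiff_pi.2 fun i => ?_
  by_cases h : p i
  · simpa only [merge_apply, h, dif_pos] using contDiff_apply ℝ ℝ (⟨i, h⟩ : {j // p j})
  · simpa only [merge_apply, h, dif_neg, not_false_eq_true] using contDiff_const

variable {F : Type*} [NormedAddCommGroup F] {f : (ι → ℝ) → F}

theorem hasCompactSupport_comp_merge (hc : HasCompactSupport f) (z : {j // ¬ p j} → ℝ) :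
    HasCompactSupport fun y : {j // p j} → ℝ => f (merge y z) := by
  have hinv : Function.LeftInverse (fun (x : ι → ℝ) (i : {j // p j}) => x i)
      fun y => merge y z := fun y => restrict_merge y z
  have hmerge : Continuous fun y : {j // p j} → ℝ => merge y z :=
    (Homeomorph.piEquivPiSubtypeProd p fun _ : ι => ℝ).symm.continuous.comp
      (continuous_id.prodMk continuous_const)
  exact hc.comp_isClosedEmbedding (hinv.isClosedEmbedding (by fun_prop) hmerge)

theorem partialDeriv_comp_merge [Finite ι] [DecidableEq ι] [NormedSpace ℝ F]
    (hf : Differentiable ℝ f) (z : {j // ¬ p j} → ℝ) (i : {j // p j}) (y : {j // p j} → ℝ) :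
    partialDeriv i (fun y => f (merge y z)) y = partialDeriv (i : ι) f (merge y z) := by
  cases nonempty_fintype ι
  have hslice : Differentiable ℝ fun y : {j // p j} → ℝ => f (merge y z) :=
    hf.comp ((contDiff_merge z).differentiable (by simp))
  have h := (hslice y).hasFDerivAt.hasLineDerivAt (Pi.single i 1)
  simp only [HasLineDerivAt, merge_add_smul_single] at h
  exact h.unique ((hf _).hasFDerivAt.hasLineDerivAt _)

variable [Fintype ι]

theorem integral_le_integral_of_merge {A B : (ι → ℝ) → ℝ} (hA : Integrable A) (hB : Integrable B)
    (h : ∀ z : {j // ¬ p j} → ℝ, ∫ y : {j // p j} → ℝ, A (merge y z) ≤ ∫ y, B (merge y z)) :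
    ∫ x, A x ≤ ∫ x, B x := by
  have hmp := (volume_preserving_piEquivPiSubtypeProd (fun _ : ι => ℝ) p).symm
  have hme := (MeasurableEquiv.piEquivPiSubtypeProd (fun _ : ι => ℝ) p).symm.measurableEmbedding
  have hA' := (hmp.integrable_comp_emb hme).2 hA
  have hB' := (hmp.integrable_comp_emb hme).2 hB
  rw [← hmp.integral_comp hme A, ← hmp.integral_comp hme B]
  rw [Measure.volume_eq_prod] at hA' hB' ⊢
  refine (integral_prod_symm _ hA').trans_le (le_of_le_of_eq ?_ (integral_prod_symm _ hB').symm)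
  exact integral_mono hA'.integral_prod_right hB'.integral_prod_right h

variable [DecidableEq ι]

theorem mul_integral_norm_sq_le_of_subsystem [InnerProductSpace ℝ F] {e M : ℝ}
    {U : ({j // p j} → ℝ) → ℝ} (hU : LocallyIntegrable fun x : ι → ℝ => U fun i => x i)
    (he : ∀ g : ({j // p j} → ℝ) → F, ContDiff ℝ ∞ g → HasCompactSupport g →
      e * ∫ y, ‖g y‖ ^ 2 ≤ ∫ y, energyDensity M U g y)
    (hf : ContDiff ℝ ∞ f) (hc : HasCompactSupport f) :
    e * ∫ x, ‖f x‖ ^ 2 ≤ ∫ x, (1 / M * ∑ j : {j // p j}, ‖partialDeriv (j : ι) f x‖ ^ 2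
      + (U fun i => x i) * ‖f x‖ ^ 2) := by
  have hgrad : Integrable fun x => 1 / M * ∑ j : {j // p j}, ‖partialDeriv (j : ι) f x‖ ^ 2 :=
    (integrable_finsetSum _ fun (j : {j // p j}) _ =>
      integrable_norm_partialDeriv_sq (contDiff_infty.1 hf 1) hc (j : ι)).const_mul _
  rw [← integral_const_mul]
  refine integral_le_integral_of_merge (p := p) ((integrable_norm_sq hf.continuous hc).const_mul e)
    (hgrad.add (integrable_mul_norm_sq hU hf.continuous hc)) fun z => ?_
  have h := he _ (hf.comp (contDiff_merge z)) (hasCompactSupport_comp_merge hc z)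
  simp only [energyDensity, Function.comp_def,
    partialDeriv_comp_merge (hf.differentiable (by simp))] at h
  rw [integral_const_mul]
  simpa only [restrict_merge] using h

theorem integral_add_riccati_mul_norm_sq_le [InnerProductSpace ℝ F] {e M : ℝ} (hM : 0 ≤ M) (k : ι)
    {U : ({j // j ≠ k} → ℝ) → ℝ} {w : (ι → ℝ) → ℝ}
    (hU : LocallyIntegrable fun x : ι → ℝ => U fun i => x i) (hw : LocallyIntegrable w)
    (he : ∀ g : ({j // j ≠ k} → ℝ) → F, ContDiff ℝ ∞ g → HasCompactSupport g →
      e * ∫ y, ‖g y‖ ^ 2 ≤ ∫ y, energyDensity M U g y)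
    {φ φ' : ℝ → ℝ} (hφ : ∀ t, HasDerivAt φ (φ' t) t) (hφ' : Continuous φ')
    (hf : ContDiff ℝ ∞ f) (hc : HasCompactSupport f) :
    ∫ x, (e + (1 / M * (φ' (x k) - φ (x k) ^ 2) + w x)) * ‖f x‖ ^ 2
      ≤ ∫ x, energyDensity M (fun x : ι → ℝ => (U fun i => x i) + w x) f x := by
  have hf₁ : ContDiff ℝ 1 f := contDiff_infty.1 hf 1
  have hφc : Continuous φ := continuous_iff_continuousAt.2 fun t => (hφ t).continuousAt
  have hothers := mul_integral_norm_sq_le_of_subsystem (M := M) hU he hf hc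
  have hkinetic : ∫ x, (φ' (x k) - φ (x k) ^ 2) * ‖f x‖ ^ 2 ≤ ∫ x, ‖partialDeriv k f x‖ ^ 2 := by
    refine integral_riccati_mul_norm_sq_le (μ := volume) (φ := fun x => φ (x k)) (by fun_prop)
      (φ' := fun x => φ' (x k)) (by fun_prop) (fun x => ?_) hf₁ hc
    have := (hφ (x k + 0 * 1)).comp (0 : ℝ) (((hasDerivAt_id (0 : ℝ)).mul_const 1).const_add (x k))
    simpa [HasLineDerivAt, Function.comp_def] using this
  have hsplit : ∀ x, energyDensity M (fun x : ι → ℝ => (U fun i => x i) + w x) f x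
      = (1 / M * ∑ j : {j // j ≠ k}, ‖partialDeriv (j : ι) f x‖ ^ 2
          + (U fun i => x i) * ‖f x‖ ^ 2)
        + (1 / M * ‖partialDeriv k f x‖ ^ 2 + w x * ‖f x‖ ^ 2) := fun x => by
    rw [energyDensity, Fintype.sum_eq_add_sum_subtype_ne _ k]
    ring
  have hwf := integrable_mul_norm_sq hw hf.continuous hc
  have hφf : Integrable fun x => (φ' (x k) - φ (x k) ^ 2) * ‖f x‖ ^ 2 :=
    integrable_mul_norm_sq (Continuous.locallyIntegrable (by fun_prop)) hf.continuous hc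
  have hk := (integrable_norm_partialDeriv_sq hf₁ hc k).const_mul (1 / M)
  simp_rw [hsplit, add_mul, mul_assoc]
  rw [integral_add ((integrable_norm_sq hf.continuous hc).const_mul e)
      ((hφf.const_mul _).fun_add hwf), integral_add (hφf.const_mul _) hwf,
    integral_add (.fun_add (.const_mul (integrable_finsetSum _ fun j _ =>
      integrable_norm_partialDeriv_sq hf₁ hc _) _) (integrable_mul_norm_sq hU hf.continuous hc))
      (hk.fun_add hwf), integral_add hk hwf]
  simp only [integral_const_mul]
  gcongr

end Merge

section RemoveParticle

variable {ι : Type} [Fintype ι] [LinearOrder ι] {Z M e : ℝ} {V : ι → ℝ → ℝ} {W : ι → ι → ℝ → ℝ}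

/-- The potential energy of particle `k` in the field of the nucleus and of all other particles.
Only the `W i j` with `i < j` enter. -/
def particlePotential (Z : ℝ) (V : ι → ℝ → ℝ) (W : ι → ι → ℝ → ℝ) (k : ι) (x : ι → ℝ) : ℝ :=
  (∑ j : {j // j ≠ k}, if (j : ι) < k then W j k (x j - x k) else W k j (x k - x j))
    - Z * V k (x k)

theorem potential_eq_add_particlePotential (k : ι) (x : ι → ℝ) :
    potential Z V W x = potential Z (fun j : {j // j ≠ k} => V j) (fun i j => W i j) (fun i => x i)
      + particlePotential Z V W k x := by
  have hsplit : (∑ j : {j // j ≠ k}, if (j : ι) < k then W j k (x j - x k) else W k j (x k - x j))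
      = (∑ j : {j // j ≠ k}, if k < (j : ι) then W k j (x k - x j) else 0)
        + ∑ j : {j // j ≠ k}, if (j : ι) < k then W j k (x j - x k) else 0 := by
    rw [← Finset.sum_add_distrib]
    refine Finset.sum_congr rfl fun j _ => ?_
    rcases lt_or_gt_of_ne j.2 with h | h <;> simp [h, h.not_gt]
  simp only [potential, particlePotential, hsplit, Fintype.sum_eq_add_sum_subtype_ne _ k,
    Finset.sum_add_distrib, lt_irrefl, if_false, Subtype.coe_lt_coe]
  ring

theorem locallyIntegrable_particlePotential (hV : ∀ j, LocallyIntegrable (V j))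
    (hW : ∀ j k, j < k → LocallyIntegrable (W j k)) (k : ι) :
    LocallyIntegrable (particlePotential Z V W k) := by
  refine LocallyIntegrable.sub (locallyIntegrable_finsetSum _ fun j _ => ?_)
    ((locallyIntegrable_comp_eval (hV k)).smul Z)
  rcases lt_or_gt_of_ne j.2 with h | h
  · simpa only [h, if_true] using locallyIntegrable_comp_sub (hW j k h) h.ne
  · simpa only [h.not_gt, if_false] using locallyIntegrable_comp_sub (hW k j h) h.ne

/-- A lower bound for the energy gained by adding particle `k` to the others: its potential energy
and the Riccati lower bound `(φ' - φ²)/M` for its kinetic energy. -/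
def addedEnergy (Z M : ℝ) (V : ι → ℝ → ℝ) (W : ι → ι → ℝ → ℝ) (φ φ' : ℝ → ℝ) (k : ι)
    (x : ι → ℝ) : ℝ :=
  1 / M * (φ' (x k) - φ (x k) ^ 2) + particlePotential Z V W k x

variable {φ φ' : ℝ → ℝ}

theorem locallyIntegrable_addedEnergy (hV : ∀ j, LocallyIntegrable (V j))
    (hW : ∀ j k, j < k → LocallyIntegrable (W j k)) (hφ : Continuous φ) (hφ' : Continuous φ')
    (k : ι) : LocallyIntegrable (addedEnergy Z M V W φ φ' k) :=
  (Continuous.locallyIntegrable (by fun_prop)).add (locallyIntegrable_particlePotential hV hW k)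

theorem integral_addedEnergy_mul_norm_sq_le (hM : 0 ≤ M) (hV : ∀ j, LocallyIntegrable (V j))
    (hW : ∀ j k, j < k → LocallyIntegrable (W j k)) (k : ι)
    (he : (e : EReal) ≤ groundEnergy Z M (fun j : {j // j ≠ k} => V j) fun i j => W i j)
    (hφ : ∀ t, HasDerivAt φ (φ' t) t) (hφ' : Continuous φ') {f : (ι → ℝ) → ℂ}
    (hf : ContDiff ℝ ∞ f) (hc : HasCompactSupport f) :
    ∫ x, (e + addedEnergy Z M V W φ φ' k x) * ‖f x‖ ^ 2
      ≤ ∫ x, energyDensity M (potential Z V W) f x := by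
  have hw := locallyIntegrable_particlePotential (Z := Z) hV hW k
  have hU : LocallyIntegrable fun x : ι → ℝ =>
      potential Z (fun j : {j // j ≠ k} => V j) (fun i j => W i j) fun i => x i := by
    simpa only [Pi.sub_def, potential_eq_add_particlePotential k, add_sub_cancel_right] using
      (locallyIntegrable_potential (Z := Z) hV hW).sub hw
  rw [funext (potential_eq_add_particlePotential k)]
  exact integral_add_riccati_mul_norm_sq_le hM k hU hw (fun g hg hgc =>
    mul_integral_norm_sq_le_of_le_groundEnergy (fun j => hV j) (fun i j => hW i j) he hg hgc)
    hφ hφ' hf hc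

end RemoveParticle

section Localization

theorem sum_norm_smul_sq {κ F : Type*} [Fintype κ] [NormedAddCommGroup F] [NormedSpace ℝ F]
    {a : κ → ℝ} {r : ℝ} (h : ∑ k, a k ^ 2 = r ^ 2) (v : F) :
    ∑ k, ‖a k • v‖ ^ 2 = ‖r • v‖ ^ 2 := by
  simp only [norm_smul, mul_pow, Real.norm_eq_abs, sq_abs, ← Finset.sum_mul, h]

variable {ι κ : Type*} [Fintype ι] [DecidableEq ι] [Fintype κ] {F : Type*} [NormedAddCommGroup F]
  [InnerProductSpace ℝ F] {M e : ℝ} {U ρ : (ι → ℝ) → ℝ} {χ : κ → (ι → ℝ) → ℝ} {f : (ι → ℝ) → F}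

theorem sum_energyDensity_smul_le (hM : 0 ≤ M) (hχ : ∀ k, Differentiable ℝ (χ k))
    (hρ : Differentiable ℝ ρ) (hf : Differentiable ℝ f) (hsum : ∀ x, ∑ k, χ k x ^ 2 = ρ x ^ 2)
    (x : ι → ℝ) :
    ∑ k, energyDensity M U (fun y => χ k y • f y) x ≤ energyDensity M U (fun y => ρ y • f y) x
      + (1 / M * ∑ k, ∑ j, partialDeriv j (χ k) x ^ 2) * ‖f x‖ ^ 2 := by
  have hims := Finset.sum_le_sum fun j (_ : j ∈ Finset.univ) => sum_norm_fderiv_smul_sq_le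
    (fun k => hχ k x) (hρ x) (hf x) hsum (Pi.single j 1)
  rw [Finset.sum_add_distrib, ← Finset.sum_mul] at hims
  have hscaled := mul_le_mul_of_nonneg_left hims (one_div_nonneg.2 hM)
  simp only [energyDensity, partialDeriv, Finset.sum_add_distrib, ← Finset.mul_sum,
    sum_norm_smul_sq (hsum x)]
  rw [Finset.sum_comm, Finset.sum_comm (f := fun k j => fderiv ℝ (χ k) x (Pi.single j 1) ^ 2)]
  linarith

theorem mul_norm_sq_add_sum_energyDensity_smul_le (hM : 0 ≤ M) (hχ : ∀ k, Differentiable ℝ (χ k))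
    (hρ : Differentiable ℝ ρ) (hf : Differentiable ℝ f) (hsum : ∀ x, ∑ k, χ k x ^ 2 = ρ x ^ 2)
    {c : κ → ℝ} {x : ι → ℝ}
    (herr : 1 / M * ∑ k, ∑ j, partialDeriv j (χ k) x ^ 2 ≤ ∑ k, c k * χ k x ^ 2) :
    e * ‖ρ x • f x‖ ^ 2 + ∑ k, energyDensity M U (fun y => χ k y • f y) x
      ≤ energyDensity M U (fun y => ρ y • f y) x + ∑ k, (e + c k) * ‖χ k x • f x‖ ^ 2 := by
  have hims := sum_energyDensity_smul_le (U := U) hM hχ hρ hf hsum x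
  have herr' := mul_le_mul_of_nonneg_right herr (sq_nonneg ‖f x‖)
  have hc : ∑ k, c k * ‖χ k x • f x‖ ^ 2 = (∑ k, c k * χ k x ^ 2) * ‖f x‖ ^ 2 := by
    simp only [norm_smul, mul_pow, Real.norm_eq_abs, sq_abs, Finset.sum_mul, mul_assoc]
  simp only [add_mul, Finset.sum_add_distrib, ← Finset.mul_sum, hc, sum_norm_smul_sq (hsum x)]
  linarith

theorem mul_integral_norm_sq_le_of_localization (hM : 0 ≤ M) (hU : LocallyIntegrable U)
    (hχ : ∀ k, ContDiff ℝ ∞ (χ k)) (hpos : ∀ x, 0 < ∑ k, χ k x ^ 2) {c : κ → (ι → ℝ) → ℝ}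
    (hc : ∀ k, LocallyIntegrable (c k))
    (hlow : ∀ k (g : (ι → ℝ) → F), ContDiff ℝ ∞ g → HasCompactSupport g →
      ∫ x, (e + c k x) * ‖g x‖ ^ 2 ≤ ∫ x, energyDensity M U g x)
    (herr : ∀ x, 1 / M * ∑ k, ∑ j, partialDeriv j (χ k) x ^ 2 ≤ ∑ k, c k x * χ k x ^ 2)
    (hf : ContDiff ℝ ∞ f) (hfc : HasCompactSupport f) :
    e * ∫ x, ‖f x‖ ^ 2 ≤ ∫ x, energyDensity M U f x := by
  set ρ : (ι → ℝ) → ℝ := fun x => √(∑ k, χ k x ^ 2)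
  have hρ : ContDiff ℝ ∞ ρ :=
    (ContDiff.sum fun k _ => (hχ k).pow 2).sqrt fun x => (hpos x).ne'
  have hρpos : ∀ x, ρ x ≠ 0 := fun x => (Real.sqrt_pos.2 (hpos x)).ne'
  have hsum : ∀ x, ∑ k, χ k x ^ 2 = ρ x ^ 2 := fun x => (Real.sq_sqrt (hpos x).le).symm
  set u : (ι → ℝ) → F := fun x => (ρ x)⁻¹ • f x
  have hu : ContDiff ℝ ∞ u := (hρ.inv hρpos).smul hf
  have hfu : f = fun x => ρ x • u x := funext fun x => (smul_inv_smul₀ (hρpos x) (f x)).symm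
  set g : κ → (ι → ℝ) → F := fun k x => χ k x • u x
  have hg : ∀ k, ContDiff ℝ ∞ (g k) := fun k => (hχ k).smul hu
  have hgc : ∀ k, HasCompactSupport (g k) := fun k => hfc.smul_left.smul_left
  have hpointwise : ∀ x, e * ‖f x‖ ^ 2 + ∑ k, energyDensity M U (g k) x
      ≤ energyDensity M U f x + ∑ k, (e + c k x) * ‖g k x‖ ^ 2 := fun x => by
    rw [hfu]
    exact mul_norm_sq_add_sum_energyDensity_smul_le hM (fun k => (hχ k).differentiable (by simp))
      (hρ.differentiable (by simp)) (hu.differentiable (by simp)) hsum (herr x)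
  have hE : ∀ k, Integrable (energyDensity M U (g k)) := fun k =>
    integrable_energyDensity hU (contDiff_infty.1 (hg k) 1) (hgc k)
  have hEf := integrable_energyDensity (M := M) hU (contDiff_infty.1 hf 1) hfc
  have hL : ∀ k, Integrable fun x => (e + c k x) * ‖g k x‖ ^ 2 := fun k =>
    integrable_mul_norm_sq ((locallyIntegrable_const e).add (hc k)) (hg k).continuous (hgc k)
  have hnf := (integrable_norm_sq hf.continuous hfc (μ := volume)).const_mul e
  have hint := integral_mono (hnf.fun_add (integrable_finsetSum _ fun k _ => hE k))
    (hEf.fun_add (integrable_finsetSum _ fun k _ => hL k)) hpointwise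
  rw [integral_add hnf (integrable_finsetSum _ fun k _ => hE k),
    integral_add hEf (integrable_finsetSum _ fun k _ => hL k), integral_const_mul,
    integral_finsetSum _ fun k _ => hE k, integral_finsetSum _ fun k _ => hL k] at hint
  have hsumlow := Finset.sum_le_sum fun k (_ : k ∈ Finset.univ) => hlow k (g k) (hg k) (hgc k)
  linarith

end Localization

section Repulsion

theorem sum_partialDeriv_comp_eval_sq {ι : Type*} [Fintype ι] [DecidableEq ι] {ψ : ℝ → ℝ} {d : ℝ}
    {k : ι} {x : ι → ℝ} (hψ : HasDerivAt ψ d (x k)) :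
    ∑ j, partialDeriv j (fun x => ψ (x k)) x ^ 2 = d ^ 2 := by
  have hcomp := hψ.comp_hasFDerivAt x (hasFDerivAt_apply (𝕜 := ℝ) k x)
  have hpartial : ∀ j, partialDeriv j (fun x => ψ (x k)) x = d * (Pi.single j 1 : ι → ℝ) k :=
    fun j => congrArg (fun L : (ι → ℝ) →L[ℝ] ℝ => L (Pi.single j 1)) hcomp.fderiv
  simp [hpartial, Pi.single_apply, ite_pow]

theorem half_add_le_add_sq_div_sqrt {R d : ℝ} (hR : 0 < R) (hd : 0 < d) (hdR : d ≤ R) (a b : ℝ) :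
    (√(a ^ 2 + R ^ 2) + √(b ^ 2 + R ^ 2)) / 2
      ≤ (√(a ^ 2 + R ^ 2) ^ 2 + √(b ^ 2 + R ^ 2) ^ 2) / √((a - b) ^ 2 + 4 * d ^ 2) := by
  have hp : √(a ^ 2 + R ^ 2) ^ 2 = a ^ 2 + R ^ 2 := Real.sq_sqrt (by positivity)
  have hq : √(b ^ 2 + R ^ 2) ^ 2 = b ^ 2 + R ^ 2 := Real.sq_sqrt (by positivity)
  have hr : √((a - b) ^ 2 + 4 * d ^ 2) ^ 2 = (a - b) ^ 2 + 4 * d ^ 2 := Real.sq_sqrt (by positivity)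
  have hrpos : 0 < √((a - b) ^ 2 + 4 * d ^ 2) := Real.sqrt_pos.2 (by positivity)
  set p := √(a ^ 2 + R ^ 2)
  set q := √(b ^ 2 + R ^ 2)
  set r := √((a - b) ^ 2 + 4 * d ^ 2)
  have hle : r ^ 2 ≤ 2 * (p ^ 2 + q ^ 2) := by
    rw [hr, hp, hq]
    nlinarith [sq_nonneg (a + b), pow_le_pow_left₀ hd.le hdR 2]
  rw [le_div_iff₀ hrpos]
  nlinarith [sq_nonneg (p + q - r), sq_nonneg (p - q)]

theorem card_sub_one_div_two_mul_sum_le {ι : Type*} [Fintype ι] [DecidableEq ι] {a : ι → ℝ}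
    {P : ι → ι → ℝ} (h : ∀ j k, j ≠ k → (a j + a k) / 2 ≤ P k j + P j k) :
    ((Fintype.card ι : ℝ) - 1) / 2 * ∑ k, a k ≤ ∑ k, ∑ j : {j // j ≠ k}, P k j := by
  have hdiag : ∑ k, ∑ j : {j // j ≠ k}, P k j = ∑ k, ∑ j, (P k j - if j = k then P k k else 0) := by
    refine Finset.sum_congr rfl fun k _ => ?_
    rw [Finset.sum_sub_distrib, Fintype.sum_eq_add_sum_subtype_ne _ k]
    simp
  have hsymm : ∑ k, ∑ j, (P k j - if j = k then P k k else 0)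
      = 1 / 2 * ∑ k, ∑ j, (P k j + P j k - if j = k then 2 * P k k else 0) := by
    simp only [Finset.sum_sub_distrib, Finset.sum_add_distrib, Finset.sum_ite_eq', Finset.mem_univ,
      if_true, ← Finset.mul_sum]
    rw [Finset.sum_comm (f := fun k j => P j k)]
    ring
  have hpair : ∀ k j, (a j + a k) / 2 - (if j = k then a k else 0)
      ≤ P k j + P j k - if j = k then 2 * P k k else 0 := by
    intro k j
    rcases eq_or_ne j k with rfl | hjk
    · simp only [if_true]
      linarith
    · simpa only [hjk, if_false, sub_zero] using h j k hjk
  have hcount : ∑ k, ∑ j, ((a j + a k) / 2 - (if j = k then a k else 0))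
      = (Fintype.card ι : ℝ) * ∑ k, a k - ∑ k, a k := by
    simp only [Finset.sum_sub_distrib, ← Finset.sum_div, Finset.sum_add_distrib]
    simp [← Finset.mul_sum]
  have hsum := Finset.sum_le_sum fun k (_ : k ∈ Finset.univ) =>
    Finset.sum_le_sum fun j (_ : j ∈ Finset.univ) => hpair k j
  rw [hdiag, hsymm]
  linarith

variable {ι : Type} [Fintype ι] [LinearOrder ι] {Z Z' M R d e : ℝ} {V : ι → ℝ → ℝ}
  {W : ι → ι → ℝ → ℝ} {φ φ' : ℝ → ℝ}

theorem sub_div_sqrt_le_addedEnergy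
    (hV : ∀ j t, Z * V j t - Z' / √(t ^ 2 + R ^ 2) ≤ 1 / M * (φ' t - φ t ^ 2))
    (hW : ∀ j k, j < k → ∀ t, 1 / √(t ^ 2 + 4 * d ^ 2) ≤ W j k t) (k : ι) (x : ι → ℝ) :
    ∑ j : {j // j ≠ k}, 1 / √((x j - x k) ^ 2 + 4 * d ^ 2) - Z' / √(x k ^ 2 + R ^ 2)
      ≤ addedEnergy Z M V W φ φ' k x := by
  have hpair : ∑ j : {j // j ≠ k}, 1 / √((x j - x k) ^ 2 + 4 * d ^ 2)
      ≤ ∑ j : {j // j ≠ k}, if (j : ι) < k then W j k (x j - x k) else W k j (x k - x j) := by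
    refine Finset.sum_le_sum fun j _ => ?_
    split_ifs with h
    · exact hW j k h _
    · rw [sub_sq_comm]
      exact hW k j (lt_of_le_of_ne (not_lt.1 h) (Ne.symm j.2)) _
  have hk := hV k (x k)
  rw [addedEnergy, particlePotential]
  linarith

theorem mul_card_le_sum_addedEnergy_mul_sq (hM : 0 ≤ M) (hR : 0 < R) (hd : 0 < d) (hdR : d ≤ R)
    (hV : ∀ j t, Z * V j t - Z' / √(t ^ 2 + R ^ 2) ≤ 1 / M * (φ' t - φ t ^ 2))
    (hW : ∀ j k, j < k → ∀ t, 1 / √(t ^ 2 + 4 * d ^ 2) ≤ W j k t)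
    (hcard : Z' + 1 / M / R ≤ ((Fintype.card ι : ℝ) - 1) / 2) (x : ι → ℝ) :
    1 / M * Fintype.card ι ≤ ∑ k, addedEnergy Z M V W φ φ' k x * √(x k ^ 2 + R ^ 2) ^ 2 := by
  set q : ι → ℝ := fun k => √(x k ^ 2 + R ^ 2)
  have hq : ∀ k, R ≤ q k := fun k => Real.le_sqrt_of_sq_le (by nlinarith [sq_nonneg (x k)])
  have hpairs : ((Fintype.card ι : ℝ) - 1) / 2 * ∑ k, q k
      ≤ ∑ k, ∑ j : {j // j ≠ k}, q k ^ 2 / √((x j - x k) ^ 2 + 4 * d ^ 2) := by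
    refine card_sub_one_div_two_mul_sum_le
      (P := fun k j => q k ^ 2 / √((x j - x k) ^ 2 + 4 * d ^ 2)) fun j k _ => ?_
    rw [sub_sq_comm (x k), ← add_div, add_comm (q k ^ 2)]
    exact half_add_le_add_sq_div_sqrt hR hd hdR _ _
  have hadded : ∑ k, ∑ j : {j // j ≠ k}, q k ^ 2 / √((x j - x k) ^ 2 + 4 * d ^ 2) - Z' * ∑ k, q k
      ≤ ∑ k, addedEnergy Z M V W φ φ' k x * q k ^ 2 := by
    rw [Finset.mul_sum, ← Finset.sum_sub_distrib]
    refine Finset.sum_le_sum fun k _ => ?_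
    refine le_of_eq_of_le ?_ (mul_le_mul_of_nonneg_right
      (sub_div_sqrt_le_addedEnergy hV hW k x) (sq_nonneg (q k)))
    rw [sub_mul, Finset.sum_mul, div_mul_eq_mul_div, mul_div_assoc, pow_two, mul_self_div_self]
    simp only [one_div_mul_eq_div, q, pow_two]
  calc 1 / M * Fintype.card ι = 1 / M / R * ∑ _k : ι, R := by
        simp only [Finset.sum_const, Finset.card_univ, nsmul_eq_mul]
        field_simp
    _ ≤ 1 / M / R * ∑ k, q k := by gcongr with k; exact hq k
    _ ≤ (((Fintype.card ι : ℝ) - 1) / 2 - Z') * ∑ k, q k := by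
        have := Finset.sum_nonneg fun k (_ : k ∈ Finset.univ) => hR.le.trans (hq k)
        gcongr
        linarith
    _ ≤ ∑ k, addedEnergy Z M V W φ φ' k x * q k ^ 2 := by linarith

theorem mul_integral_norm_sq_le_of_repulsion [Nonempty ι] (hM : 0 ≤ M) (hR : 0 < R) (hd : 0 < d)
    (hdR : d ≤ R) (hVint : ∀ j : ι, LocallyIntegrable (V j))
    (hWint : ∀ j k, j < k → LocallyIntegrable (W j k))
    (hφ : ∀ t, HasDerivAt φ (φ' t) t) (hφ' : Continuous φ')
    (hV : ∀ j t, Z * V j t - Z' / √(t ^ 2 + R ^ 2) ≤ 1 / M * (φ' t - φ t ^ 2))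
    (hW : ∀ j k, j < k → ∀ t, 1 / √(t ^ 2 + 4 * d ^ 2) ≤ W j k t)
    (hcard : Z' + 1 / M / R ≤ ((Fintype.card ι : ℝ) - 1) / 2)
    (he : ∀ k : ι, (e : EReal) ≤
      groundEnergy (ι := {j : ι // j ≠ k}) Z M (fun j => V j) fun i j => W i j)
    {f : (ι → ℝ) → ℂ} (hf : ContDiff ℝ ∞ f) (hc : HasCompactSupport f) :
    e * ∫ x, ‖f x‖ ^ 2 ≤ ∫ x, energyDensity M (potential Z V W) f x := by
  have hφc : Continuous φ := continuous_iff_continuousAt.2 fun t => (hφ t).continuousAt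
  refine mul_integral_norm_sq_le_of_localization hM (locallyIntegrable_potential hVint hWint)
    (χ := fun k x => √(x k ^ 2 + R ^ 2))
    (fun k => ContDiff.sqrt (by fun_prop) fun x => by positivity)
    (fun x => Finset.sum_pos (fun k _ => by positivity) Finset.univ_nonempty)
    (locallyIntegrable_addedEnergy hVint hWint hφc hφ')
    (fun k g => integral_addedEnergy_mul_norm_sq_le hM hVint hWint k (he k) hφ hφ') (fun x => ?_)
    hf hc
  refine le_trans ?_ (mul_card_le_sum_addedEnergy_mul_sq hM hR hd hdR hV hW hcard x)
  gcongr
  refine (Finset.sum_le_card_nsmul _ _ 1 fun k _ => ?_).trans_eq (by simp)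
  rw [sum_partialDeriv_comp_eval_sq (hasDerivAt_sqrt_sq_add_sq hR.ne' (x k)), div_pow,
    Real.sq_sqrt (by positivity)]
  exact div_le_one_of_le₀ (by nlinarith [sq_nonneg R]) (by positivity)

end Repulsion

section BoundState

variable {N : ℕ} {Z M : ℝ} {V : Fin N → ℝ → ℝ} {W : Fin N → Fin N → ℝ → ℝ}

theorem not_hasBoundState_of_riccati_le {Z' R d : ℝ} {φ φ' : ℝ → ℝ} (hZ' : 0 ≤ Z') (hM : 0 ≤ M)
    (hR : 0 < R) (hd : 0 < d) (hdR : d ≤ R) (hVint : ∀ j, LocallyIntegrable (V j))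
    (hWint : ∀ j k, j < k → LocallyIntegrable (W j k))
    (hφ : ∀ t, HasDerivAt φ (φ' t) t) (hφ' : Continuous φ')
    (hV : ∀ j t, Z * V j t - Z' / √(t ^ 2 + R ^ 2) ≤ 1 / M * (φ' t - φ t ^ 2))
    (hW : ∀ j k, j < k → ∀ t, 1 / √(t ^ 2 + 4 * d ^ 2) ≤ W j k t)
    (hcard : Z' + 1 / M / R ≤ ((N : ℝ) - 1) / 2) :
    ¬ HasBoundState Z M V W := by
  intro h
  have hN : 0 < N := by
    have : 0 ≤ 1 / M / R := by positivity
    have : (0 : ℝ) < N := by linarith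
    exact_mod_cast this
  have : Nonempty (Fin N) := ⟨⟨0, hN⟩⟩
  obtain ⟨k, hmin⟩ := Finite.exists_min (groundEnergyOmit Z M V W)
  obtain ⟨⟨f, hf, hc, hnorm⟩, hlt⟩ := iInf_lt_iff.1 (h k)
  obtain ⟨e, hfe, hek⟩ := EReal.lt_iff_exists_real_btwn.1 hlt
  rw [EReal.coe_lt_coe_iff,
    re_integral_conj_mul_hamiltonian hVint hWint (contDiff_infty.1 hf 2) hc] at hfe
  have hle := mul_integral_norm_sq_le_of_repulsion hM hR hd hdR hVint hWint hφ hφ' hV hW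
    (by simpa only [Fintype.card_fin] using hcard) (fun i => hek.le.trans (hmin i)) hf hc
  rw [hnorm, mul_one] at hle
  exact hfe.not_ge hle

variable {s : ℝ}

theorem not_hasBoundState_of_mul_le_one (hZ : 0 < Z) (hM : 0 < M) (hs : 0 < s)
    (hMZs : M * Z * s ≤ 1) (hVint : ∀ j, LocallyIntegrable (V j))
    (hWint : ∀ j k, j < k → LocallyIntegrable (W j k))
    (hV : ∀ j t, V j t ≤ 1 / √(t ^ 2 + s ^ 2))
    (hW : ∀ j k, j < k → ∀ t, 1 / √(t ^ 2 + 4 * s ^ 2) ≤ W j k t)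
    (hN : 1 + Z * (30 + 6 * Real.log (2 / (M * Z * s)) ^ 2) ≤ N) :
    ¬ HasBoundState Z M V W := by
  set R : ℝ := 1 / (M * Z) with hRdef
  have hR : 0 < R := by positivity
  have hsR : s ≤ R := by rwa [hRdef, le_div_iff₀ (by positivity), mul_comm]
  have hMR : 1 / M = Z * R := by rw [hRdef]; field_simp
  have hlog : 2 / (M * Z * s) = 2 * R / s := by rw [hRdef]; field_simp
  rw [hlog] at hN
  refine not_hasBoundState_of_riccati_le
    (Z' := Z * (14 + 3 * Real.log (2 * R / s) ^ 2)) (by positivity) hM.le hR hs hsR hVint hWint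
    (hasDerivAt_riccati hs hR.ne') (continuous_riccatiDeriv hs.ne' hR.ne') (fun j t => ?_) hW ?_
  · calc Z * V j t - Z * (14 + 3 * Real.log (2 * R / s) ^ 2) / √(t ^ 2 + R ^ 2)
        ≤ Z * (1 / √(t ^ 2 + s ^ 2))
          - Z * (14 + 3 * Real.log (2 * R / s) ^ 2) / √(t ^ 2 + R ^ 2) := by gcongr; exact hV j t
      _ = Z * (1 / √(t ^ 2 + s ^ 2)
          - (14 + 3 * Real.log (2 * R / s) ^ 2) / √(t ^ 2 + R ^ 2)) := by ring
      _ ≤ Z * (R * (riccatiDeriv s R t - riccati s R t ^ 2)) := by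
          gcongr; exact riccati_inequality hs hsR t
      _ = 1 / M * (riccatiDeriv s R t - riccati s R t ^ 2) := by rw [hMR, mul_assoc]
  · rw [hMR, mul_div_cancel_right₀ _ hR.ne']
    linarith

theorem not_hasBoundState_of_one_le_mul (hZ : 0 < Z) (hM : 0 < M) (hs : 0 < s)
    (hMZs : 1 ≤ M * Z * s) (hVint : ∀ j, LocallyIntegrable (V j))
    (hWint : ∀ j k, j < k → LocallyIntegrable (W j k))
    (hV : ∀ j t, V j t ≤ 1 / √(t ^ 2 + s ^ 2))
    (hW : ∀ j k, j < k → ∀ t, 1 / √(t ^ 2 + 4 * s ^ 2) ≤ W j k t) (hN : 1 + 4 * Z ≤ N) :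
    ¬ HasBoundState Z M V W := by
  refine not_hasBoundState_of_riccati_le (φ := 0) (φ' := 0) hZ.le hM.le hs hs le_rfl hVint hWint
    (fun t => hasDerivAt_const t 0) continuous_zero (fun j t => ?_) hW ?_
  · have hVt := mul_le_mul_of_nonneg_left (hV j t) hZ.le
    rw [mul_one_div] at hVt
    simpa using hVt
  · have hMs : 1 / M / s ≤ Z := by
      rw [div_div, div_le_iff₀ (by positivity)]
      linarith
    linarith

theorem not_hasBoundState_of_coulomb_bounds (hZ : 0 < Z) (hM : 0 < M) (hs : 0 < s)
    (hVint : ∀ j, LocallyIntegrable (V j)) (hWint : ∀ j k, j < k → LocallyIntegrable (W j k))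
    (hV : ∀ j t, V j t ≤ 1 / √(t ^ 2 + s ^ 2))
    (hW : ∀ j k, j < k → ∀ t, 1 / √(t ^ 2 + 4 * s ^ 2) ≤ W j k t)
    (hN : 1 + Z * (30 + 6 * Real.posLog (2 / (M * Z * s)) ^ 2) ≤ N) :
    ¬ HasBoundState Z M V W := by
  rcases le_total (M * Z * s) 1 with hMZs | hMZs
  · rw [Real.posLog_eq_log] at hN
    · exact not_hasBoundState_of_mul_le_one hZ hM hs hMZs hVint hWint hV hW hN
    · rw [abs_of_pos (by positivity), le_div_iff₀ (by positivity)]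
      linarith
  · refine not_hasBoundState_of_one_le_mul hZ hM hs hMZs hVint hWint hV hW (le_trans ?_ hN)
    nlinarith [sq_nonneg (Real.posLog (2 / (M * Z * s)))]

end BoundState

theorem posLog_two_div_sq {B Z ν : ℝ} (hB : 0 ≤ B) (hν : 0 ≤ ν) :
    Real.posLog (2 / (B ^ (-(1 / 2) : ℝ) * Z * √(ν / 2))) ^ 2
      = 1 / 4 * Real.posLog (8 * B / (ν * Z ^ 2)) ^ 2 := by
  have hsq : 8 * B / (ν * Z ^ 2) = (2 / (B ^ (-(1 / 2) : ℝ) * Z * √(ν / 2))) ^ 2 := by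
    rw [Real.rpow_neg hB, ← Real.sqrt_eq_rpow, div_pow, mul_pow, mul_pow, inv_pow,
      Real.sq_sqrt hB, Real.sq_sqrt (by positivity)]
    field_simp
    ring
  rw [hsq, Real.posLog_pow]
  push_cast
  ring

theorem one_add_mul_posLog_sq_le_of_lt_exp {α Z B ν : ℝ} (hα : 0 < α) (hZ : 1 ≤ Z) (hB : 0 < B)
    (hν : 1 ≤ ν) (hBZ : B < Real.exp (Z ^ (α / 4))) :
    1 + Z * (30 + 3 / 2 * Real.posLog (8 * B / (ν * Z ^ 2)) ^ 2)
      ≤ 2 * Z + 60 * Z ^ (1 + α) := by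
  have hT : 1 ≤ Z ^ (α / 4) := Real.one_le_rpow hZ (by positivity)
  have hdrop : 8 * B / (ν * Z ^ 2) ≤ 8 * B :=
    div_le_self (by positivity) (one_le_mul_of_one_le_of_one_le hν (one_le_pow₀ hZ))
  have hlogB : Real.posLog B ≤ Z ^ (α / 4) :=
    max_le (by positivity) ((Real.log_le_iff_le_exp hB).2 hBZ.le)
  have hlog8 : Real.log (8 : ℕ) ≤ 3 := by
    rw [show ((8 : ℕ) : ℝ) = 2 ^ 3 by norm_num, Real.log_pow]
    push_cast
    linarith [Real.log_two_lt_d9]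
  have hlog : Real.posLog (8 * B / (ν * Z ^ 2)) ≤ 4 * Z ^ (α / 4) := by
    have hmono := Real.posLog_le_posLog (by positivity) hdrop
    have hmul : Real.posLog (8 * B) ≤ Real.log (8 : ℕ) + Real.posLog B := Real.posLog_nat_mul
    linarith
  have hpow : Z * (Z ^ (α / 4)) ^ 2 ≤ Z ^ (1 + α) := by
    have hZ0 : 0 < Z := by linarith
    rw [← Real.rpow_mul_natCast hZ0.le, ← Real.rpow_one_add' hZ0.le (by positivity)]
    exact Real.rpow_le_rpow_of_exponent_le hZ (by push_cast; linarith)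
  have hZpow : Z ≤ Z ^ (1 + α) := Real.self_le_rpow_of_one_le hZ (by linarith)
  calc 1 + Z * (30 + 3 / 2 * Real.posLog (8 * B / (ν * Z ^ 2)) ^ 2)
      ≤ 1 + Z * (30 + 3 / 2 * (4 * Z ^ (α / 4)) ^ 2) := by gcongr; exact Real.posLog_nonneg
    _ = 1 + 30 * Z + 24 * (Z * (Z ^ (α / 4)) ^ 2) := by ring
    _ ≤ 2 * Z + 60 * Z ^ (1 + α) := by linarith

end StrongField

end

theorem theorem1_general {N : ℕ} {Z B : ℝ} {μ ν : ℕ} {V : Fin N → ℝ → ℝ}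
    {W : Fin N → Fin N → ℝ → ℝ} (hZ : 0 < Z) (hB : 0 < B) (hν : 1 ≤ ν) (hνμ : ν ≤ 2 * μ)
    (hVint : ∀ j, MeasureTheory.LocallyIntegrable (V j))
    (hWint : ∀ j k, j < k → MeasureTheory.LocallyIntegrable (W j k))
    (hV : ∀ j x, V j x ≤ StrongField.landauPotential μ x)
    (hW : ∀ j k, j < k → ∀ x,
      1 / √2 * StrongField.landauPotential (ν - 1) (x / √2) ≤ W j k x)
    (hN : 1 + Z * (30 + 3 / 2 * Real.posLog (8 * B / (ν * Z ^ 2)) ^ 2) ≤ N) :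
    ¬ StrongField.HasBoundState Z (B ^ (-(1 / 2) : ℝ)) V W := by
  have hν0 : (0 : ℝ) < ν / 2 := by positivity
  have hsq : √((ν : ℝ) / 2) ^ 2 = ν / 2 := Real.sq_sqrt hν0.le
  have hνμ' : (ν : ℝ) / 2 ≤ μ := by
    have : (ν : ℝ) ≤ 2 * μ := by exact_mod_cast hνμ
    linarith
  refine StrongField.not_hasBoundState_of_coulomb_bounds hZ (by positivity) (Real.sqrt_pos.2 hν0)
    hVint hWint (fun j t => ?_) (fun j k hjk t => ?_) ?_
  · rw [hsq]
    exact (hV j t).trans (StrongField.landauPotential_le_one_div_sqrt hν0 hνμ' t)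
  · rw [hsq, show 4 * ((ν : ℝ) / 2) = 2 * ν by ring]
    exact (StrongField.one_div_sqrt_le_scaled_landauPotential hν t).trans (hW j k hjk t)
  · rw [StrongField.posLog_two_div_sq hB.le ν.cast_nonneg]
    linarith

theorem theorem1 :
    ∃ a₁ : ℝ, 0 < a₁ ∧ ∃ a₂ : ℝ → ℝ → ℝ, (∀ γ C : ℝ, 0 < a₂ γ C) ∧
      ∀ α : ℝ, 0 < α → ∃ A : ℝ, 0 < A ∧
        ∀ (γ C : ℝ) (N : ℕ) (Z B : ℝ) (μ ν : ℕ)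
          (V : Fin N → ℝ → ℝ) (W : Fin N → Fin N → ℝ → ℝ),
          1 ≤ Z →
          1 ≤ ν → ν ≤ 2 * μ →
          (∀ j, MeasureTheory.LocallyIntegrable (V j)) →
          (∀ j k, j < k → MeasureTheory.LocallyIntegrable (W j k)) →
          (∀ j x, V j x ≤ StrongField.landauPotential μ x) →
          (∀ j k, j < k → ∀ x,
            1 / Real.sqrt 2 * StrongField.landauPotential (ν - 1) (x / Real.sqrt 2) ≤ W j k x) →
          (((ν : ℝ) ≤ C ∧ 2 < γ) ∨ ((ν : ℝ) ≤ C * N ∧ 3 < γ)) →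
          2 * Z + A * Z ^ (1 + α) < (N : ℝ) →
          a₂ γ C * Z ^ γ ≤ B →
          B < a₁ * Real.exp (Z ^ (α / 4)) →
          ¬ StrongField.HasBoundState Z (B ^ (-(1 / 2) : ℝ)) V W := by
  refine ⟨1, one_pos, fun _ _ => 1, fun _ _ => one_pos, fun α hα => ⟨60, by norm_num, ?_⟩⟩
  intro γ C N Z B μ ν V W hZ hν hνμ hVint hWint hV hW _ hN hZB hBZ
  have hB : 0 < B := lt_of_lt_of_le (by positivity) hZB
  refine theorem1_general (by linarith) hB hν hνμ hVint hWint hV hW (le_trans ?_ hN.le)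
  exact StrongField.one_add_mul_posLog_sq_le_of_lt_exp hα hZ hB (by exact_mod_cast hν)
    (by rwa [one_mul] at hBZ)
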